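/- Let $\mathfrak g$ be a finite-dimensional simple complex Lie algebra with an $\mathfrak{sl}_2$-triple $(e,h,f)$ and the invariant symmetric bilinear form with $(e,f)=1$, $(h,h)=2$. Put $\mathfrak g(i)=\{a:[\tfrac h2,a]=ia\}$, let $\mathfrak n=\bigoplus_{i>0}\mathfrak g(i)$, let $d$ be the largest eigenvalue of $\operatorname{ad}\tfrac h2$, and let $p\in\mathfrak g(d)$, $k\in\mathbb C$, $m\in\mathbb Z_{\ge0}$. On $\hat{\mathfrak g}=\mathfrak g((z))$ use the bracket $[az^i,bz^j]=[a,b]z^{i+j}$, the form $(az^i,bz^j)=(a,b)\delta_{i+j,0}$ and the degree $\deg(az^j)=i+(d+1)j$ for $a\in\mathfrak g(i)$, and put $\Lambda_m=-fz^{-m}-pz^{-m-1}$. Fix a basis $(u_i)$ of $\mathfrak g$ of eigenvectors of $\operatorname{ad}\tfrac h2$, with dual basis $(\tilde u_i)$, and write $u_i^j=u_iz^j$. Let $\mathcal I$ be the set of $(i,j)$ with $j\ge0$ and $\deg u_i^j<(d+1)m+1$, and let $\mathcal V$ be the algebra of differential polynomials in the $u_i^j$, $(i,j)\in\mathcal I$,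 with derivation $\partial$. An element $u_i^j$ with $j\ge0$ and $(i,j)\notin\mathcal I$ is read in $\mathcal V$ as the constant $(\Lambda_m,u_i^j)$ if $\deg u_i^j=(d+1)m+1$, and as $0$ if its degree is larger. Let $\{\cdot_\lambda\cdot\}_1$ and $\{\cdot_\lambda\cdot\}_2$ be the $\lambda$-brackets on $\mathcal V$ given through the master formula $$\{\varphi_\lambda\psi\}=\sum\frac{\partial\psi}{\partial u_\beta^{(n)}}(\lambda+\partial)^n\{u_\alpha{}_{\,\lambda+\partial}\,u_\beta\}_{\to}(-\lambda-\partial)^l\frac{\partial\varphi}{\partial u_\alpha^{(l)}}$$ by the following brackets of the generators: $\{az^i{}_\lambda bz^j\}_1=-[a,b]z^{i+j+1}$; and $\{az^i{}_\lambda bz^j\}_2$ equals $[a,b]+k(a,b)\lambda$ if $i=j=0$, equals $-[a,b]z^{i+j}$ if $i,j>0$, and is $0$ otherwise. Let $\mathcal W(\mathfrak g,\Lambda_m,k)\subset\mathcal V$ be the differential subalgebra of all $\varphi$ with $(\operatorname{ad}_\lambda n)\varphi=0$ for all $n\in\mathfrak n$, where $(\operatorname{ad}_\lambda n)(az^j)=[n,a]z^j+\delta_{j,0}k\lambda(n,a)$,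 extended by the Leibniz rule and $(\operatorname{ad}_\lambda n)\partial=(\lambda+\partial)(\operatorname{ad}_\lambda n)$. Let $\mathcal L=k\partial+Q+\Lambda_m$ with $Q=\sum_{(i,j)\in\mathcal I}\tilde u_iz^{-j}\otimes u_i^j$. Here $\hat{\mathfrak g}\otimes\mathcal V$ is completed to formal Laurent series in $z$ with coefficients in $\mathfrak g\otimes\mathcal V$, and $[\partial,X]=\partial X$. Assume that $\Lambda_m$ is semisimple, that is, $\operatorname{ad}\Lambda_m$ is a semisimple $\mathbb C((z))$-linear endomorphism of $\hat{\mathfrak g}$. Let $b\in\ker\operatorname{ad}\Lambda_m$ have only components of negative degree, and assume that $b$ commutes with $\ker\operatorname{ad}\Lambda_m$ (which is automatic if this kernel is abelian). Then there are $S$ with only components of positive degree and $\mathsf h\in\ker\operatorname{ad}\Lambda_m$, both in $\hat{\mathfrak g}\otimes\mathcal V$, such that $e^{\operatorname{ad}S}\mathcal L=k\partial+\Lambda_m+\mathsf h$. For every such pair $(S,\mathsf h)$ put $H_b=(b,\mathsf h)$, $H_{z^{-1}b}=(z^{-1}b,\mathsf h)$ and $M=e^{-\operatorname{ad}S}b$,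 and let $M^{>0}$ and $M^{\le0}$ be the parts of $M$ with positive and non-positive powers of $z$. For $N\in\hat{\mathfrak g}\otimes\mathcal V$ let $X_N$ be the derivation of $\mathcal V$ that commutes with $\partial$ and satisfies $X_N(u)=(N,[u,Q+\Lambda_m])+k\,\partial(N,u)$ for each generator $u=u_i^j$. Then the evolution equation $\frac{\partial\varphi}{\partial t}=-X_{M^{>0}}(\varphi)=X_{M^{\le0}}(\varphi)$ is Hamiltonian for both $\lambda$-brackets: $$\frac{\partial\varphi}{\partial t}=\{H_{z^{-1}b}{}_{\,\lambda}\,\varphi\}_1\big|_{\lambda=0}=\{H_b{}_{\,\lambda}\,\varphi\}_2\big|_{\lambda=0}\qquad\text{for all }\varphi\in\mathcal W(\mathfrak g,\Lambda_m,k).$$ -/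

import Mathlib

open TensorProduct

noncomputable section

namespace FracW

/-! ### Loop algebras with coefficients -/

/-- The coefficientwise `ℂ`-algebra structure of `R((z))`; stated so that instance search does not
take a detour over power series. -/
instance laurentAlgebra (R : Type*) [CommRing R] [Algebra ℂ R] : Algebra ℂ (LaurentSeries R) :=
  HahnSeries.instAlgebra

/-- The loop algebra `𝔤((z))` with coefficients in a commutative algebra `R`, that is, formal Laurent
series in `z` with coefficients in `𝔤 ⊗ R`. Since `𝔤` will be finite dimensional, this is
`R((z)) ⊗ 𝔤`, with the bracket extended `R((z))`-bilinearly. For `R = ℂ` it is `𝔤((z))` itself. -/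
abbrev Loop (R 𝔤 : Type*) [CommRing R] [Algebra ℂ R] [LieRing 𝔤] [LieAlgebra ℂ 𝔤] : Type _ :=
  LaurentSeries R ⊗[ℂ] 𝔤

section Instances

/-! Shortcuts to the instances that Mathlib provides on base changes of Lie algebras. -/

variable (R 𝔤 : Type*) [CommRing R] [Algebra ℂ R] [LieRing 𝔤] [LieAlgebra ℂ 𝔤]

instance loopLieRing : LieRing (Loop R 𝔤) :=
  LieAlgebra.ExtendScalars.instLieRing ℂ (LaurentSeries R) 𝔤

instance loopLieRingModule : LieRingModule (Loop R 𝔤) (Loop R 𝔤) := lieRingSelfModule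

instance loopLieAlgebra : LieAlgebra (LaurentSeries R) (Loop R 𝔤) :=
  LieAlgebra.ExtendScalars.instLieAlgebra ℂ (LaurentSeries R) 𝔤

instance loopBaseLieAlgebra : LieAlgebra ℂ (Loop R 𝔤) :=
  LieAlgebra.ExtendScalars.instBaseLieAlgebra ℂ (LaurentSeries R) 𝔤

instance loopBracket : Bracket (Loop R 𝔤) (Loop R 𝔤) := LieRing.toBracket

end Instances

/-- Application of a linear map to all coefficients of a Laurent series. -/
def laurentMap {R R' : Type*} [CommRing R] [Algebra ℂ R] [CommRing R'] [Algebra ℂ R']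
    (g : R →ₗ[ℂ] R') : LaurentSeries R →ₗ[ℂ] LaurentSeries R' where
  toFun x := HahnSeries.map x g
  map_add' x y := by ext n; simp
  map_smul' c x := by ext n; simp

/-- Application of a linear map to the coefficients of an element of the loop algebra:
`a z ^ j ⊗ r ↦ a z ^ j ⊗ g r`. -/
def loopMap {R R' : Type*} (𝔤 : Type*) [CommRing R] [Algebra ℂ R] [CommRing R'] [Algebra ℂ R']
    [LieRing 𝔤] [LieAlgebra ℂ 𝔤] (g : R →ₗ[ℂ] R') : Loop R 𝔤 →ₗ[ℂ] Loop R' 𝔤 :=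
  (laurentMap g).rTensor 𝔤

section Loop

variable (R : Type*) {𝔤 : Type*} [CommRing R] [Algebra ℂ R] [LieRing 𝔤] [LieAlgebra ℂ 𝔤]

/-- The element `a z ^ j ⊗ r`. -/
def mono {R : Type*} [CommRing R] [Algebra ℂ R] (a : 𝔤) (j : ℤ) (r : R) : Loop R 𝔤 :=
  HahnSeries.single j r ⊗ₜ[ℂ] a

/-- The projection `X ↦ X ^ {≤ 0}` onto non-positive powers of `z`. -/
def nonposPart : Loop R 𝔤 →ₗ[ℂ] Loop R 𝔤 :=
  (HahnSeries.truncLTLinearMap ℂ (1 : ℤ)).rTensor 𝔤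

/-- The projection `X ↦ X ^ {> 0}` onto positive powers of `z`. -/
def posPart : Loop R 𝔤 →ₗ[ℂ] Loop R 𝔤 :=
  LinearMap.id - nonposPart R

end Loop

/-! ### The data -/

/-- The data on which the construction depends: an `sl₂`-triple `(e, h, f)` in `𝔤`, the invariant
symmetric bilinear form with `(e, f) = 1`, the largest eigenvalue `d` of `ad (h / 2)`,
an element `p` of the eigenspace `𝔤(d)`, and a basis `u` of `𝔤` consisting of eigenvectors of
`ad (h / 2)` together with its dual basis. The eigenvalues of `ad (h / 2)` are half-integers, and
all of them are stored after doubling, as eigenvalues of `ad h`. -/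
structure Data (ι 𝔤 : Type*) [DecidableEq ι] [LieRing 𝔤] [LieAlgebra ℂ 𝔤] where
  e : 𝔤
  h : 𝔤
  f : 𝔤
  triple : IsSl2Triple h e f
  form : LinearMap.BilinForm ℂ 𝔤
  form_symm : ∀ x y, form x y = form y x
  form_inv : ∀ x y z, form ⁅x, y⁆ z = form x ⁅y, z⁆
  form_e_f : form e f = 1
  form_h_h : form h h = 2
  /-- `dd = 2 d`, the largest eigenvalue of `ad h`. -/
  dd : ℤ
  dd_greatest : IsGreatest {n : ℤ | ∃ x : 𝔤, x ≠ 0 ∧ ⁅h, x⁆ = (n : ℂ) • x} dd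
  p : 𝔤
  p_mem : ⁅h, p⁆ = (dd : ℂ) • p
  u : Module.Basis ι ℂ 𝔤
  /-- `wt i` is the eigenvalue of `ad h` on `u i`. -/
  wt : ι → ℤ
  lie_h_u : ∀ i, ⁅h, u i⁆ = (wt i : ℂ) • u i
  ut : Module.Basis ι ℂ 𝔤
  dual : ∀ i j, form (u i) (ut j) = if i = j then 1 else 0

namespace Data

variable {ι 𝔤 : Type*} [Fintype ι] [DecidableEq ι] [LieRing 𝔤] [LieAlgebra ℂ 𝔤]
variable (D : Data ι 𝔤)

/-- Twice the degree `gr₂` of `u i z ^ j`, where `gr₂` is the gradation by the eigenvalues of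
`(d + 1) z ∂_z + ad (h / 2)`. -/
def deg (i : ι) (j : ℤ) : ℤ := D.wt i + (D.dd + 2) * j

/-- Twice the number `(d + 1) m + 1`. -/
def top (m : ℕ) : ℤ := (D.dd + 2) * m + 2

/-- The `R`-coefficient of `u i z ^ j` in an element of the loop algebra. -/
def coef {R : Type*} [CommRing R] [Algebra ℂ R] (X : Loop R 𝔤) (i : ι) (j : ℤ) : R :=
  ((D.u.baseChange (LaurentSeries R)).repr X i).coeff j

/-- The bilinear form `(a z ^ i ⊗ r, b z ^ j ⊗ s) = (a, b) δ_{i + j, 0} r s`. -/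
def pair {R : Type*} [CommRing R] [Algebra ℂ R] (X Y : Loop R 𝔤) : R :=
  (D.form.baseChange (LaurentSeries R) X Y).coeff 0

/-- `Λ_m = - f z ^ {- m} - p z ^ {- m - 1}`. -/
def Lam (R : Type*) [CommRing R] [Algebra ℂ R] (m : ℕ) : Loop R 𝔤 :=
  -mono D.f (-(m : ℤ)) 1 - mono D.p (-(m : ℤ) - 1) 1

/-! ### The differential algebra `𝒱_{[d, m]}` -/

/-- The index set of the basis of `ĝ^{≥ 0}_{< (d + 1) m + 1}` formed by the `u i z ^ j` with `j ≥ 0`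
and `gr₂ (u i z ^ j) < (d + 1) m + 1`. This inequality forces `j ≤ m`, as the eigenvalues of
`ad (h / 2)` are at least `- d`. -/
abbrev Idx (m : ℕ) : Type _ :=
  {x : ι × Fin (m + 1) // D.deg x.1 (x.2 : ℕ) < D.top m}

/-- The algebra `𝒱_{[d, m]}` of differential polynomials in the `u i z ^ j` of the index set; the
variable `(x, n)` is the `n`-th derivative of the variable with index `x`. -/
abbrev V (m : ℕ) : Type _ := MvPolynomial (D.Idx m × ℕ) ℂ

/-- The derivation `∂` of `𝒱_{[d, m]}`. -/
def del (m : ℕ) : Derivation ℂ (D.V m) (D.V m) :=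
  MvPolynomial.mkDerivation ℂ fun x => MvPolynomial.X (x.1, x.2 + 1)

/-- The class of `u i z ^ j` (`j ≥ 0`) in `𝒱_{[d, m]}`: a variable if the degree is smaller than
`(d + 1) m + 1`, the constant `(Λ_m, u i z ^ j)` if the degree is equal to it, and zero if the degree
is larger. -/
def gen (m : ℕ) (i : ι) (j : ℕ) : D.V m :=
  if hx : ∃ hj : j < m + 1, D.deg i ((⟨j, hj⟩ : Fin (m + 1)) : ℕ) < D.top m then
    MvPolynomial.X (⟨(i, ⟨j, hx.1⟩), hx.2⟩, 0)
  else if D.deg i j = D.top m then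
    MvPolynomial.C (D.pair (D.Lam ℂ m) (mono (D.u i) j 1))
  else 0

/-- The class of `a z ^ j` in `𝒱_{[d, m]}`, for `a ∈ 𝔤` and `j ≥ 0`. -/
def cls (m : ℕ) (a : 𝔤) (j : ℕ) : D.V m :=
  ∑ i, D.u.repr a i • D.gen m i j

/-! ### `λ`-brackets; the indeterminate `λ` is `Polynomial.X` -/

/-- The operator `λ + ∂` on `𝒱[λ]`. -/
def lamDel (m : ℕ) (P : Polynomial (D.V m)) : Polynomial (D.V m) :=
  Polynomial.X * P + P.sum fun n c => Polynomial.monomial n (D.del m c)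

/-- `P (λ + ∂) F` with `∂` acting on `F`: for `P = ∑ c_n λ ^ n` this is `∑ c_n (λ + ∂) ^ n F`. -/
def arrow (m : ℕ) (P F : Polynomial (D.V m)) : Polynomial (D.V m) :=
  P.sum fun n c => Polynomial.C c * (D.lamDel m)^[n] F

/-- The `λ`-bracket `{φ_λ ψ}` on `𝒱_{[d, m]}` with prescribed brackets `B i j = {u_i _λ u_j}` of the
generators, given by the master formula
`∑ ∂ψ/∂u_j^{(n)} (λ + ∂)^n {u_i _{λ + ∂} u_j}_→ (- λ - ∂)^l ∂φ/∂u_i^{(l)}`. -/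
def lamBracket (m : ℕ) (B : D.Idx m → D.Idx m → Polynomial (D.V m)) (φ ψ : D.V m) :
    Polynomial (D.V m) :=
  MvPolynomial.mkDerivation ℂ (fun y : D.Idx m × ℕ =>
    (D.lamDel m)^[y.2] (∑ x : D.Idx m, D.arrow m (B x y.1)
      (∑ᶠ l : ℕ, (fun F => -D.lamDel m F)^[l]
        (Polynomial.C (MvPolynomial.pderiv (x, l) φ))))) ψ

/-- `{a z ^ i _λ b z ^ j}₁ = - [a, b] z ^ {i + j + 1}`. -/
def gen₁ (m : ℕ) (x y : D.Idx m) : Polynomial (D.V m) :=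
  -Polynomial.C (D.cls m ⁅D.u x.1.1, D.u y.1.1⁆ ((x.1.2 : ℕ) + (y.1.2 : ℕ) + 1))

/-- `{a _λ b}₂ = [a, b] + k (a, b) λ`, `{a z ^ i _λ b z ^ j}₂ = - [a, b] z ^ {i + j}` if `i, j > 0`, and
`{a z ^ i _λ b z ^ j}₂ = 0` if exactly one of `i, j` is zero. -/
def gen₂ (k : ℂ) (m : ℕ) (x y : D.Idx m) : Polynomial (D.V m) :=
  if (x.1.2 : ℕ) = 0 ∧ (y.1.2 : ℕ) = 0 then
    Polynomial.C (D.cls m ⁅D.u x.1.1, D.u y.1.1⁆ 0) +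
      Polynomial.C (MvPolynomial.C (k * D.form (D.u x.1.1) (D.u y.1.1))) * Polynomial.X
  else if (x.1.2 : ℕ) = 0 ∨ (y.1.2 : ℕ) = 0 then 0
  else -Polynomial.C (D.cls m ⁅D.u x.1.1, D.u y.1.1⁆ ((x.1.2 : ℕ) + (y.1.2 : ℕ)))

/-- The first `λ`-bracket. -/
def bracket₁ (m : ℕ) (φ ψ : D.V m) : Polynomial (D.V m) := D.lamBracket m (D.gen₁ m) φ ψ

/-- The second `λ`-bracket. -/
def bracket₂ (k : ℂ) (m : ℕ) (φ ψ : D.V m) : Polynomial (D.V m) :=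
  D.lamBracket m (D.gen₂ k m) φ ψ

/-! ### The fractional `𝒲`-algebra -/

/-- The subspace `𝔫 = ⨁_{i ≥ 1/2} 𝔤(i)`. -/
def IsNil (n : 𝔤) : Prop := ∀ i, D.wt i ≤ 0 → D.u.repr n i = 0

/-- The action `(ad_λ n) φ`: `(ad_λ n)(a z ^ j) = [n, a] z ^ j + δ_{j, 0} k λ (n, a)`, extended by
`(ad_λ n) ∂φ = (λ + ∂) (ad_λ n) φ` and the Leibniz rule. -/
def adLam (k : ℂ) (m : ℕ) (n : 𝔤) : Derivation ℂ (D.V m) (Polynomial (D.V m)) :=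
  MvPolynomial.mkDerivation ℂ fun y : D.Idx m × ℕ => (D.lamDel m)^[y.2]
    (Polynomial.C (D.cls m ⁅n, D.u y.1.1.1⁆ (y.1.1.2 : ℕ)) +
      if (y.1.1.2 : ℕ) = 0 then
        Polynomial.C (MvPolynomial.C (k * D.form n (D.u y.1.1.1))) * Polynomial.X
      else 0)

/-- The affine fractional `𝒲`-algebra `𝒲(𝔤, Λ_m, k) = 𝒱_{[d, m]} ^ {ad_λ 𝔫}`. -/
def W (k : ℂ) (m : ℕ) : Set (D.V m) := {φ | ∀ n : 𝔤, D.IsNil n → D.adLam k m n φ = 0}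

/-! ### Lax operators and gauge diagonalization -/

/-- `∂ (a ⊗ φ) = a ⊗ ∂φ`. -/
def loopDel (m : ℕ) : Loop (D.V m) 𝔤 →ₗ[ℂ] Loop (D.V m) 𝔤 :=
  loopMap 𝔤 (D.del m : D.V m →ₗ[ℂ] D.V m)

/-- `Q + Λ_m ⊗ 1` with `Q = ∑ ũ_i z ^ {- j} ⊗ u_i z ^ j`, so that `k ∂ + Q + Λ_m ⊗ 1` is the universal Lax
operator. -/
def lax (m : ℕ) : Loop (D.V m) 𝔤 :=
  (∑ x : D.Idx m, mono (D.ut x.1.1) (-((x.1.2 : ℕ) : ℤ)) (MvPolynomial.X (x, 0) : D.V m)) + D.Lam (D.V m) m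

/-- The adjoint action of `S` on `ℂ ∂ ⋉ (ĝ ⊗ 𝒱)`: the pair `(c, X)` stands for `c ∂ + X`, and
`[S, ∂] = - ∂S`. -/
def adLax (m : ℕ) (S : Loop (D.V m) 𝔤) (L : ℂ × Loop (D.V m) 𝔤) : ℂ × Loop (D.V m) 𝔤 :=
  (0, ⁅S, L.2⁆ - L.1 • D.loopDel m S)

/-- `L' = e ^ {ad S} L`: in every coefficient the partial sums of `∑ (ad S) ^ r L / r!` are eventually
equal to the coefficient of `L'`. -/
def IsExpAd (m : ℕ) (S : Loop (D.V m) 𝔤) (L L' : ℂ × Loop (D.V m) 𝔤) : Prop :=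
  L'.1 = L.1 ∧ ∀ (i : ι) (j : ℤ), ∀ᶠ N in Filter.atTop,
    D.coef (∑ r ∈ Finset.range N, ((r.factorial : ℂ)⁻¹) • ((D.adLax m S)^[r] L).2) i j =
      D.coef L'.2 i j

/-- `S` has positive degree, `H` lies in the kernel of `ad Λ_m`, and
`e ^ {ad S} (k ∂ + Q + Λ_m ⊗ 1) = k ∂ + Λ_m ⊗ 1 + H`. -/
def IsDiag (k : ℂ) (m : ℕ) (S H : Loop (D.V m) 𝔤) : Prop :=
  (∀ i j, D.deg i j ≤ 0 → D.coef S i j = 0) ∧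
  ⁅D.Lam (D.V m) m, H⁆ = 0 ∧
  D.IsExpAd m S (k, D.lax m) (k, D.Lam (D.V m) m + H)

/-- The inclusion `b ↦ b ⊗ 1` of `ĝ` into `ĝ ⊗ 𝒱`. -/
def incl (m : ℕ) : Loop ℂ 𝔤 →ₗ[ℂ] Loop (D.V m) 𝔤 :=
  loopMap 𝔤 (Algebra.linearMap ℂ (D.V m))

/-- The functional `H_b = (b ⊗ 1, H)`, for a gauge diagonalized operator `k ∂ + Λ_m ⊗ 1 + H`. -/
def Ham (m : ℕ) (b : Loop ℂ 𝔤) (H : Loop (D.V m) 𝔤) : D.V m := D.pair (D.incl m b) H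

/-- For `N ∈ ĝ ⊗ 𝒱` the derivation commuting with `∂`
`φ ↦ ∫ (N(x) δ(x - w), [∑ u_i^j ⊗ ∂φ/∂u_i^{j (n)}(y) ∂_y^n δ(y - w), k ∂ + Q(w) + Λ_m])_w dx`.
On a generator `u = u_i z ^ j` the delta functions integrate out, with `[u δ, k ∂] = - k u ∂δ` and an
integration by parts, to `k ∂ (N, u) + (N, [u, Q + Λ_m])`. -/
def flow (k : ℂ) (m : ℕ) (N : Loop (D.V m) 𝔤) : Derivation ℂ (D.V m) (D.V m) :=
  MvPolynomial.mkDerivation ℂ fun y : D.Idx m × ℕ => (D.del m)^[y.2]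
    (k • D.del m (D.pair N (mono (D.u y.1.1.1) ((y.1.1.2 : ℕ) : ℤ) (1 : D.V m))) +
      D.pair N ⁅mono (D.u y.1.1.1) ((y.1.1.2 : ℕ) : ℤ) (1 : D.V m), D.lax m⁆)

end Data

end FracW

end

open TensorProduct Filter Finset

set_option linter.unusedSectionVars false

noncomputable section

namespace FracW

/-! ### Products of Laurent series as finite sums -/

section LaurentCoefficients

variable {R : Type*} [CommRing R]

/-! Write `L = k∂ + Q + Λ_m` and `L' = k∂ + Λ_m + H`. Degrees are doubled to be integers; `Λ_m` is
homogeneous of degree `-top` and `Q` has only components of larger degree. Exponentials are never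
formed as operators: each identity between them is proved for partial sums modulo the degree
filtration, which is separated and complete.

Diagonalization. Semisimplicity splits the loop algebra into kernel and image of `ad Λ_m`, so the
part of `e^{ad S} L` outside the kernel can be removed one degree at a time by correcting `S`; the
corrections have growing degree and converge (`exists_solution`, `exists_isDiag`).

The two forms of the flow. The element `b` is constant and commutes with `Λ_m` and `H`, so `[L', b]
= 0`. Conjugating back gives `[L, M] = 0` (`act_eq_zero_of_isExpAd`); by invariance of the form `X_M
= 0`, hence `X_{M^{≤0}} = -X_{M^{>0}}`.

Variational derivatives. This is the heart. The Fréchet derivative `d` in the direction of one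
generator takes values in `𝒱[λ]` and intertwines `∂` with `λ + ∂`. Differentiating `e^{ad S} L = L'`
gives `dL' = e^{ad S} dL - [L', Ξ]` with `Ξ = ∑ (ad S)^n dS / (n + 1)!`. Paired with `b`, the
commutator becomes `k(λ + ∂)(b, Ξ)`, which dies under `λ^n ↦ (-∂)^n`. What remains is `(M, dL)` with
`dL = ũ_i z^{-j}`: the variational derivative of `H_b` is the coefficient of `u_i z^j` in `M`
(`apply_pair_const_d`, `varDer_Ham`).

Comparison. At `λ = 0` the master formula is the evolutionary derivation with characteristic `∑ B(∂)
δH/δu` (`eval_zero_lamBracket`). Passing to `z⁻¹b` replaces `M` by `z⁻¹M`, and the shift makes the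
first bracket equal to `-X_{M^{>0}}` (`sum_gen₁`). The second gives `X_{M^{≤0}}` on generators with
`j = 0` and `-X_{M^{>0}}` on the others. Non-generators are harmless for degree reasons, except that
for `m = 0` the `u_i` of degree at least one leave gauge terms (`flowChar_nonposPart`). These lie
along `𝔫` and vanish on `𝒲`, the only point where `φ ∈ 𝒲` matters. -/

theorem eventually_coeff_mul (x y : LaurentSeries R) (n : ℤ) : ∀ᶠ K : ℕ in atTop,
    (x * y).coeff n = ∑ i ∈ Finset.Icc (-(K : ℤ)) K, x.coeff i * y.coeff (n - i) := by
  classical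
  set A := Finset.antidiagonal x.isPWO_support y.isPWO_support n
  have key : ∀ s : Finset ℤ, A.image Prod.fst ⊆ s →
      (x * y).coeff n = ∑ i ∈ s, x.coeff i * y.coeff (n - i) := by
    intro s hs
    rw [HahnSeries.coeff_mul, ← Finset.sum_subset hs]
    · rw [Finset.sum_image]
      · refine Finset.sum_congr rfl fun ij hij => ?_
        have := (Finset.mem_antidiagonal.1 hij).2.2
        rw [← this, add_sub_cancel_left]
      · intro a ha b hb hab
        have h1 := (Finset.mem_antidiagonal.1 ha).2.2
        have h2 := (Finset.mem_antidiagonal.1 hb).2.2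
        exact Prod.ext hab (by have hab' : a.1 = b.1 := hab
                               omega)
    · intro i _ hi
      by_contra hne
      refine hi (Finset.mem_image.2 ⟨(i, n - i), Finset.mem_antidiagonal.2 ⟨?_, ?_, ?_⟩, rfl⟩)
      · exact left_ne_zero_of_mul hne
      · exact right_ne_zero_of_mul hne
      · simp
  -- Only finitely many exponents contribute, so every large window contains them all. Stating this
  -- eventually lets several products share one window.
  obtain ⟨K, hK⟩ : ∃ K : ℕ, ∀ i ∈ A.image Prod.fst, i.natAbs ≤ K :=
    ⟨(A.image Prod.fst).sup Int.natAbs, fun i hi => Finset.le_sup (f := Int.natAbs) hi⟩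
  filter_upwards [eventually_ge_atTop K] with N hN
  refine key _ fun i hi => ?_
  have := hK i hi
  rw [Finset.mem_Icc]
  omega

theorem exists_coeff_of_coeff_mul_ne_zero {x y : LaurentSeries R} {n : ℤ}
    (h : (x * y).coeff n ≠ 0) : ∃ i j, i + j = n ∧ x.coeff i ≠ 0 ∧ y.coeff j ≠ 0 := by
  obtain ⟨K, hK⟩ := (eventually_coeff_mul x y n).exists
  rw [hK] at h
  obtain ⟨i, -, hi⟩ := Finset.exists_ne_zero_of_sum_ne_zero h
  exact ⟨i, n - i, by ring, left_ne_zero_of_mul hi, right_ne_zero_of_mul hi⟩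

end LaurentCoefficients

/-! ### Applying linear maps to coefficients -/

section LoopMap

variable {R R₁ R₂ R₃ R₄ : Type*} [CommRing R] [Algebra ℂ R] [CommRing R₁] [Algebra ℂ R₁]
  [CommRing R₂] [Algebra ℂ R₂] [CommRing R₃] [Algebra ℂ R₃] [CommRing R₄] [Algebra ℂ R₄]
  {𝔤 : Type*} [LieRing 𝔤] [LieAlgebra ℂ 𝔤]

@[simp] theorem laurentMap_coeff (g : R₁ →ₗ[ℂ] R₂) (x : LaurentSeries R₁) (n : ℤ) :
    (laurentMap g x).coeff n = g (x.coeff n) := rfl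

@[simp] theorem loopMap_tmul (g : R₁ →ₗ[ℂ] R₂) (x : LaurentSeries R₁) (a : 𝔤) :
    loopMap 𝔤 g (x ⊗ₜ a) = laurentMap g x ⊗ₜ a := rfl

/-- The hypothesis has two terms so that one proof serves algebra maps and scalar multiplication
(second term zero) as well as derivations, connections and Fréchet derivatives. `loopMap_lie` and
`map_pair` carry it over to the bracket and the pairing. -/
theorem laurentMap_mul (f : R₃ →ₗ[ℂ] R₄) (a : R₁ →ₗ[ℂ] R₃) (b : R₂ →ₗ[ℂ] R₃)
    (a₁ a₂ : R₁ →ₗ[ℂ] R₄) (b₁ b₂ : R₂ →ₗ[ℂ] R₄)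
    (h : ∀ r s, f (a r * b s) = a₁ r * b₁ s + a₂ r * b₂ s)
    (x : LaurentSeries R₁) (y : LaurentSeries R₂) :
    laurentMap f (laurentMap a x * laurentMap b y) =
      laurentMap a₁ x * laurentMap b₁ y + laurentMap a₂ x * laurentMap b₂ y := by
  ext n
  obtain ⟨K, h₀, h₁, h₂⟩ := ((eventually_coeff_mul (laurentMap a x) (laurentMap b y) n).and
    ((eventually_coeff_mul (laurentMap a₁ x) (laurentMap b₁ y) n).and
      (eventually_coeff_mul (laurentMap a₂ x) (laurentMap b₂ y) n))).exists
  rw [laurentMap_coeff, HahnSeries.coeff_add, h₀, h₁, h₂, map_sum, ← Finset.sum_add_distrib]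
  simp [h]

@[simp] theorem laurentMap_id (x : LaurentSeries R) : laurentMap LinearMap.id x = x := rfl

@[simp] theorem laurentMap_zero (x : LaurentSeries R₁) :
    laurentMap (0 : R₁ →ₗ[ℂ] R₂) x = 0 := by ext; simp

@[simp] theorem loopMap_id (X : Loop R 𝔤) : loopMap 𝔤 LinearMap.id X = X := by
  induction X using TensorProduct.induction_on with
  | zero => simp
  | tmul x a => simp
  | add X Y hX hY => simp [hX, hY]

@[simp] theorem loopMap_zero (X : Loop R₁ 𝔤) : loopMap 𝔤 (0 : R₁ →ₗ[ℂ] R₂) X = 0 := by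
  induction X using TensorProduct.induction_on with
  | zero => simp
  | tmul x a => simp
  | add X Y hX hY => simp [hX, hY]

theorem loopMap_loopMap (g : R₂ →ₗ[ℂ] R₃) (f : R₁ →ₗ[ℂ] R₂) (X : Loop R₁ 𝔤) :
    loopMap 𝔤 g (loopMap 𝔤 f X) = loopMap 𝔤 (g ∘ₗ f) X := by
  induction X using TensorProduct.induction_on with
  | zero => simp
  | tmul x a => rfl
  | add X Y hX hY => simp [hX, hY]

theorem loopMap_lie (f : R₃ →ₗ[ℂ] R₄) (a : R₁ →ₗ[ℂ] R₃) (b : R₂ →ₗ[ℂ] R₃)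
    (a₁ a₂ : R₁ →ₗ[ℂ] R₄) (b₁ b₂ : R₂ →ₗ[ℂ] R₄)
    (h : ∀ r s, f (a r * b s) = a₁ r * b₁ s + a₂ r * b₂ s) (X : Loop R₁ 𝔤) (Y : Loop R₂ 𝔤) :
    loopMap 𝔤 f ⁅loopMap 𝔤 a X, loopMap 𝔤 b Y⁆ =
      ⁅loopMap 𝔤 a₁ X, loopMap 𝔤 b₁ Y⁆ + ⁅loopMap 𝔤 a₂ X, loopMap 𝔤 b₂ Y⁆ := by
  induction X using TensorProduct.induction_on with
  | zero => simp
  | add X X' hX hX' =>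
    simp only [map_add, add_lie, hX, hX']
    abel
  | tmul x u =>
    induction Y using TensorProduct.induction_on with
    | zero => simp
    | add Y Y' hY hY' =>
      simp only [map_add, lie_add, hY, hY']
      abel
    | tmul y v =>
      simp only [loopMap_tmul]
      erw [LieAlgebra.ExtendScalars.bracket_tmul, LieAlgebra.ExtendScalars.bracket_tmul,
        LieAlgebra.ExtendScalars.bracket_tmul]
      rw [loopMap_tmul, laurentMap_mul f a b a₁ a₂ b₁ b₂ h, TensorProduct.add_tmul]

theorem lie_tmul (x y : LaurentSeries R) (a b : 𝔤) :
    ⁅(x ⊗ₜ a : Loop R 𝔤), (y ⊗ₜ b : Loop R 𝔤)⁆ = (x * y) ⊗ₜ ⁅a, b⁆ := rfl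

@[simp] theorem loopMap_mono (g : R₁ →ₗ[ℂ] R₂) (a : 𝔤) (j : ℤ) (r : R₁) :
    loopMap 𝔤 g (mono a j r) = mono a j (g r) := by
  rw [mono, mono, loopMap_tmul]
  congr 1
  ext n
  simp only [laurentMap_coeff, HahnSeries.coeff_single]
  split_ifs <;> simp

end LoopMap

namespace Data

variable {R R₁ R₂ R₃ R₄ : Type*} [CommRing R] [Algebra ℂ R] [CommRing R₁] [Algebra ℂ R₁]
  [CommRing R₂] [Algebra ℂ R₂] [CommRing R₃] [Algebra ℂ R₃] [CommRing R₄] [Algebra ℂ R₄]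
variable {ι 𝔤 : Type*} [Fintype ι] [DecidableEq ι] [LieRing 𝔤] [LieAlgebra ℂ 𝔤]
variable (D : Data ι 𝔤)

/-! ### The pairing -/

theorem form_baseChange_tmul (x y : LaurentSeries R) (a b : 𝔤) :
    D.form.baseChange (LaurentSeries R) (x ⊗ₜ a) (y ⊗ₜ b) = D.form a b • (x * y) := rfl

theorem pair_add_left (X X' Y : Loop R 𝔤) : D.pair (X + X') Y = D.pair X Y + D.pair X' Y := by
  simp [pair]

theorem pair_add_right (X Y Y' : Loop R 𝔤) : D.pair X (Y + Y') = D.pair X Y + D.pair X Y' := by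
  simp [pair]

/-- The pairing as a bilinear map. -/
def pairing (R : Type*) [CommRing R] [Algebra ℂ R] : Loop R 𝔤 →ₗ[ℂ] Loop R 𝔤 →ₗ[ℂ] R :=
  LinearMap.mk₂ ℂ D.pair D.pair_add_left
    (fun c X Y => by
      rw [pair, ← algebraMap_smul (LaurentSeries R) c X]
      simp only [map_smul, LinearMap.smul_apply]
      rw [algebraMap_smul]; rfl)
    D.pair_add_right
    (fun c X Y => by
      rw [pair, ← algebraMap_smul (LaurentSeries R) c Y]
      simp only [map_smul]
      rw [algebraMap_smul]; rfl)

theorem pairing_apply (X Y : Loop R 𝔤) : D.pairing R X Y = D.pair X Y := rfl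

theorem form_baseChange_symm (X Y : Loop R 𝔤) : D.form.baseChange (LaurentSeries R) X Y =
    D.form.baseChange (LaurentSeries R) Y X := by
  induction X using TensorProduct.induction_on with
  | zero => simp
  | add X X' hX hX' => simp [hX, hX']
  | tmul x a =>
    induction Y using TensorProduct.induction_on with
    | zero => simp
    | add Y Y' hY hY' => rw [map_add, map_add, LinearMap.add_apply, hY, hY']
    | tmul y b => rw [form_baseChange_tmul, form_baseChange_tmul, mul_comm, D.form_symm]

theorem pair_symm (X Y : Loop R 𝔤) : D.pair X Y = D.pair Y X := by
  rw [pair, form_baseChange_symm, pair]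

theorem form_baseChange_lie (X Y Z : Loop R 𝔤) : D.form.baseChange (LaurentSeries R) ⁅X, Y⁆ Z =
    D.form.baseChange (LaurentSeries R) X ⁅Y, Z⁆ := by
  induction X using TensorProduct.induction_on with
  | zero => simp
  | add X X' hX hX' => simp only [add_lie, map_add, LinearMap.add_apply, hX, hX']
  | tmul x a =>
    induction Y using TensorProduct.induction_on with
    | zero => simp
    | add Y Y' hY hY' => simp only [add_lie, lie_add, map_add, LinearMap.add_apply, hY, hY']
    | tmul y b =>
      induction Z using TensorProduct.induction_on with
      | zero => simp
      | add Z Z' hZ hZ' => simp only [lie_add, map_add, hZ, hZ']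
      | tmul z c =>
        rw [lie_tmul, lie_tmul, form_baseChange_tmul, form_baseChange_tmul, mul_assoc, D.form_inv]

theorem pair_lie (X Y Z : Loop R 𝔤) : D.pair ⁅X, Y⁆ Z = D.pair X ⁅Y, Z⁆ := by
  rw [pair, form_baseChange_lie, pair]

theorem map_pair (f : R₃ →ₗ[ℂ] R₄) (a : R₁ →ₗ[ℂ] R₃) (b : R₂ →ₗ[ℂ] R₃)
    (a₁ a₂ : R₁ →ₗ[ℂ] R₄) (b₁ b₂ : R₂ →ₗ[ℂ] R₄)
    (h : ∀ r s, f (a r * b s) = a₁ r * b₁ s + a₂ r * b₂ s) (X : Loop R₁ 𝔤) (Y : Loop R₂ 𝔤) :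
    f (D.pair (loopMap 𝔤 a X) (loopMap 𝔤 b Y)) =
      D.pair (loopMap 𝔤 a₁ X) (loopMap 𝔤 b₁ Y) + D.pair (loopMap 𝔤 a₂ X) (loopMap 𝔤 b₂ Y) := by
  simp only [← pairing_apply]
  induction X using TensorProduct.induction_on with
  | zero => simp
  | add X X' hX hX' =>
    simp only [map_add, LinearMap.add_apply, hX, hX']
    abel
  | tmul x u =>
    induction Y using TensorProduct.induction_on with
    | zero => simp
    | add Y Y' hY hY' =>
      simp only [map_add, hY, hY']
      abel
    | tmul y v =>
      simp only [loopMap_tmul, pairing_apply, pair, form_baseChange_tmul]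
      simp only [HahnSeries.coeff_smul, map_smul, ← smul_add]
      have := congrArg (fun w => w.coeff 0) (laurentMap_mul f a b a₁ a₂ b₁ b₂ h x y)
      simp only [laurentMap_coeff, HahnSeries.coeff_add] at this
      rw [this]

/-! ### Coefficients -/

/-- The `LaurentSeries R`-coordinate along `u i`. -/
def coord (X : Loop R 𝔤) (i : ι) : LaurentSeries R := (D.u.baseChange (LaurentSeries R)).repr X i

theorem coord_tmul (x : LaurentSeries R) (a : 𝔤) (i : ι) :
    D.coord (x ⊗ₜ a : Loop R 𝔤) i = D.u.repr a i • x :=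
  Module.Basis.baseChange_repr_tmul ..

theorem coef_eq (X : Loop R 𝔤) (i : ι) (j : ℤ) : D.coef X i j = (D.coord X i).coeff j := rfl

theorem sum_coord (X : Loop R 𝔤) : ∑ i, (D.coord X i) ⊗ₜ[ℂ] D.u i = X := by
  conv_rhs => rw [← (D.u.baseChange (LaurentSeries R)).sum_repr X]
  refine Finset.sum_congr rfl fun i _ => ?_
  rw [Module.Basis.baseChange_apply, TensorProduct.smul_tmul', smul_eq_mul, mul_one]
  rfl

theorem ext_coef {X Y : Loop R 𝔤} (h : ∀ i j, D.coef X i j = D.coef Y i j) : X = Y := by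
  rw [← D.sum_coord X, ← D.sum_coord Y]
  refine Finset.sum_congr rfl fun i _ => ?_
  congr 1
  ext j
  exact h i j

/-- The coefficient of `u i z ^ j` as a linear map. -/
def coefₗ (R : Type*) [CommRing R] [Algebra ℂ R] (i : ι) (j : ℤ) : Loop R 𝔤 →ₗ[ℂ] R where
  toFun X := D.coef X i j
  map_add' X Y := by simp [coef]
  map_smul' c X := by
    rw [coef, ← algebraMap_smul (LaurentSeries R) c X, map_smul]
    simp only [Finsupp.smul_apply, RingHom.id_apply]
    rw [algebraMap_smul]; rfl

theorem coefₗ_apply (X : Loop R 𝔤) (i : ι) (j : ℤ) : D.coefₗ R i j X = D.coef X i j := rfl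

theorem coef_add (X Y : Loop R 𝔤) (i : ι) (j : ℤ) :
    D.coef (X + Y) i j = D.coef X i j + D.coef Y i j := map_add (D.coefₗ R i j) X Y

theorem coef_sub (X Y : Loop R 𝔤) (i : ι) (j : ℤ) :
    D.coef (X - Y) i j = D.coef X i j - D.coef Y i j := map_sub (D.coefₗ R i j) X Y

theorem coef_tmul (x : LaurentSeries R) (a : 𝔤) (i : ι) (j : ℤ) :
    D.coef (x ⊗ₜ a : Loop R 𝔤) i j = D.u.repr a i • x.coeff j := by
  rw [coef_eq, coord_tmul, HahnSeries.coeff_smul]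

theorem coef_mono (a : 𝔤) (n : ℤ) (r : R) (i : ι) (j : ℤ) :
    D.coef (mono a n r : Loop R 𝔤) i j = if j = n then D.u.repr a i • r else 0 := by
  rw [mono, coef_tmul, HahnSeries.coeff_single]
  split_ifs <;> simp

theorem coef_loopMap (g : R₁ →ₗ[ℂ] R₂) (X : Loop R₁ 𝔤) (i : ι) (j : ℤ) :
    D.coef (loopMap 𝔤 g X) i j = g (D.coef X i j) := by
  simp only [← coefₗ_apply]
  induction X using TensorProduct.induction_on with
  | zero => simp
  | add X Y hX hY => simp [hX, hY]
  | tmul x a => simp [coefₗ_apply, coef_tmul]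

/-! ### Weights -/

theorem repr_lie_h (a : 𝔤) (l : ι) : D.u.repr ⁅D.h, a⁆ l = (D.wt l : ℂ) * D.u.repr a l := by
  conv_lhs => rw [← D.u.sum_repr a]
  simp only [lie_sum, lie_smul, D.lie_h_u, map_sum, map_smul, Finsupp.coe_finsetSum,
    Finset.sum_apply, Finsupp.smul_apply, Module.Basis.repr_self, smul_eq_mul]
  rw [Finset.sum_eq_single l]
  · simp; ring
  · intro i _ hi
    simp [hi]
  · simp

theorem wt_add_eq_of_repr_ne_zero {i j l : ι} (h : D.u.repr ⁅D.u i, D.u j⁆ l ≠ 0) :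
    D.wt l = D.wt i + D.wt j := by
  have h₁ : ⁅D.h, ⁅D.u i, D.u j⁆⁆ = ((D.wt i + D.wt j : ℤ) : ℂ) • ⁅D.u i, D.u j⁆ := by
    rw [leibniz_lie, D.lie_h_u, D.lie_h_u, smul_lie, lie_smul, ← add_smul]
    push_cast; rfl
  have h₂ : D.u.repr ⁅D.h, ⁅D.u i, D.u j⁆⁆ l = (D.wt l : ℂ) * D.u.repr ⁅D.u i, D.u j⁆ l :=
    D.repr_lie_h _ _
  rw [h₁, map_smul, Finsupp.smul_apply, smul_eq_mul] at h₂
  exact_mod_cast (mul_right_cancel₀ h h₂).symm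

end Data

namespace Data

variable {R R₁ R₂ : Type*} [CommRing R] [Algebra ℂ R] [CommRing R₁] [Algebra ℂ R₁]
  [CommRing R₂] [Algebra ℂ R₂]
variable {ι 𝔤 : Type*} [Fintype ι] [DecidableEq ι] [LieRing 𝔤] [LieAlgebra ℂ 𝔤]
variable (D : Data ι 𝔤)

theorem wt_eq_of_repr_ne_zero {a : 𝔤} {n : ℤ} (ha : ⁅D.h, a⁆ = (n : ℂ) • a) {i : ι}
    (hi : D.u.repr a i ≠ 0) : D.wt i = n := by
  have h := D.repr_lie_h a i
  rw [ha, map_smul, Finsupp.smul_apply, smul_eq_mul] at h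
  exact_mod_cast (mul_right_cancel₀ hi h).symm

theorem wt_add_eq_zero_of_form_ne_zero {i : ι} {a : 𝔤} {n : ℤ} (ha : ⁅D.h, a⁆ = (n : ℂ) • a)
    (hi : D.form (D.u i) a ≠ 0) : D.wt i + n = 0 := by
  have h := D.form_inv (D.u i) D.h a
  rw [← lie_skew, D.lie_h_u, ha, map_smul, map_neg, map_smul, LinearMap.neg_apply,
    LinearMap.smul_apply, smul_eq_mul, smul_eq_mul, ← neg_mul] at h
  have h' := mul_right_cancel₀ hi h
  have : ((D.wt i + n : ℤ) : ℂ) = 0 := by push_cast; rw [← h']; ring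
  exact_mod_cast this

theorem wt_le (i : ι) : D.wt i ≤ D.dd := D.dd_greatest.2 ⟨D.u i, D.u.ne_zero i, D.lie_h_u i⟩

/-- The dual basis makes the form nondegenerate, and it pairs only opposite weights, so `-wt i` is
again a weight and is at most `dd`. -/
theorem neg_dd_le_wt (i : ι) : -D.dd ≤ D.wt i := by
  obtain ⟨j, hj⟩ : ∃ j, D.form (D.u i) (D.u j) ≠ 0 := by
    by_contra! hne
    have h0 : D.form (D.u i) = 0 := D.u.ext fun j => by rw [hne j, LinearMap.zero_apply]
    have := D.dual i i
    rw [h0] at this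
    simp at this
  have := D.wt_add_eq_zero_of_form_ne_zero (D.lie_h_u j) hj
  have := D.wt_le j
  omega

theorem two_le_dd : 2 ≤ D.dd := by
  refine D.dd_greatest.2 ⟨D.e, ?_, ?_⟩
  · intro h
    have := D.form_e_f
    rw [h] at this
    simp at this
  · rw [D.triple.lie_h_e_nsmul]
    norm_num [two_smul]

theorem deg_add (i : ι) (a b : ℤ) : D.deg i (a + b) = D.deg i a + (D.dd + 2) * b := by
  simp only [deg]; ring

theorem coord_lie (X Y : Loop R 𝔤) (l : ι) : D.coord ⁅X, Y⁆ l =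
    ∑ i, ∑ j, D.u.repr ⁅D.u i, D.u j⁆ l • (D.coord X i * D.coord Y j) := by
  have hadd : ∀ (s : Finset ι) (f : ι → Loop R 𝔤),
      D.coord (∑ i ∈ s, f i) l = ∑ i ∈ s, D.coord (f i) l := by
    intro s f
    simp [coord]
  conv_lhs => rw [← D.sum_coord X, ← D.sum_coord Y]
  simp only [sum_lie, lie_sum, hadd, lie_tmul, coord_tmul]
  rw [Finset.sum_comm]

theorem exists_of_coef_lie_ne_zero {X Y : Loop R 𝔤} {l : ι} {n : ℤ} (h : D.coef ⁅X, Y⁆ l n ≠ 0) :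
    ∃ i j a b, D.coef X i a ≠ 0 ∧ D.coef Y j b ≠ 0 ∧ D.deg i a + D.deg j b = D.deg l n := by
  rw [coef_eq, coord_lie, HahnSeries.coeff_sum] at h
  obtain ⟨i, -, hi⟩ := Finset.exists_ne_zero_of_sum_ne_zero h
  rw [HahnSeries.coeff_sum] at hi
  obtain ⟨j, -, hj⟩ := Finset.exists_ne_zero_of_sum_ne_zero hi
  rw [HahnSeries.coeff_smul] at hj
  obtain ⟨a, b, hab, ha, hb⟩ := exists_coeff_of_coeff_mul_ne_zero (right_ne_zero_of_smul hj)
  refine ⟨i, j, a, b, ha, hb, ?_⟩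
  have := D.wt_add_eq_of_repr_ne_zero (left_ne_zero_of_smul hj)
  simp only [deg, this, ← hab]
  ring

theorem pair_eq_sum (X Y : Loop R 𝔤) : D.pair X Y =
    ∑ i, ∑ j, D.form (D.u i) (D.u j) • (D.coord X i * D.coord Y j).coeff 0 := by
  conv_lhs => rw [← D.sum_coord X, ← D.sum_coord Y, ← pairing_apply]
  simp only [map_sum, LinearMap.sum_apply, pairing_apply, pair, form_baseChange_tmul,
    HahnSeries.coeff_smul]
  rw [Finset.sum_comm]

theorem exists_of_pair_ne_zero {X Y : Loop R 𝔤} (h : D.pair X Y ≠ 0) :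
    ∃ i j a b, D.coef X i a ≠ 0 ∧ D.coef Y j b ≠ 0 ∧ D.deg i a + D.deg j b = 0 := by
  rw [pair_eq_sum] at h
  obtain ⟨i, -, hi⟩ := Finset.exists_ne_zero_of_sum_ne_zero h
  obtain ⟨j, -, hj⟩ := Finset.exists_ne_zero_of_sum_ne_zero hi
  obtain ⟨a, b, hab, ha, hb⟩ := exists_coeff_of_coeff_mul_ne_zero (right_ne_zero_of_smul hj)
  refine ⟨i, j, a, b, ha, hb, ?_⟩
  have h₁ := D.wt_add_eq_zero_of_form_ne_zero (D.lie_h_u j) (left_ne_zero_of_smul hj)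
  have : D.deg i a + D.deg j b = (D.wt i + D.wt j) + (D.dd + 2) * (a + b) := by
    simp only [deg]; ring
  rw [this, h₁, hab, mul_zero, add_zero]

theorem pair_mono_right (X : Loop R 𝔤) (a : 𝔤) (n : ℤ) (r : R) :
    D.pair X (mono a n r) = ∑ i, D.form (D.u i) a • (D.coef X i (-n) * r) := by
  conv_lhs => rw [← D.sum_coord X, ← pairing_apply]
  simp only [map_sum, LinearMap.sum_apply, pairing_apply, pair, mono, form_baseChange_tmul,
    HahnSeries.coeff_smul]
  refine Finset.sum_congr rfl fun i _ => ?_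
  congr 1
  have := HahnSeries.coeff_mul_single_add (r := r) (x := D.coord X i) (a := -n) (b := n)
  rwa [neg_add_cancel] at this

theorem pair_mono_ut (X : Loop R 𝔤) (i : ι) (n : ℤ) (r : R) :
    D.pair X (mono (D.ut i) n r) = D.coef X i (-n) * r := by
  rw [pair_mono_right, Finset.sum_eq_single i]
  · simp [D.dual]
  · intro j _ hj
    simp [D.dual, hj]
  · simp

/-! ### The filtration by degree -/

/-- The elements all of whose components have degree at least `d`. -/
def filt (R : Type*) [CommRing R] [Algebra ℂ R] (d : ℤ) : Submodule ℂ (Loop R 𝔤) where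
  carrier := {X | ∀ i j, D.deg i j < d → D.coef X i j = 0}
  add_mem' hX hY i j h := by rw [coef_add, hX i j h, hY i j h, add_zero]
  zero_mem' i j _ := map_zero (D.coefₗ R i j)
  smul_mem' c X hX i j h := by
    rw [← coefₗ_apply, map_smul, coefₗ_apply, hX i j h, smul_zero]

theorem filt_antitone {d d' : ℤ} (h : d ≤ d') : D.filt R d' ≤ D.filt R d :=
  fun _ hX i j hij => hX i j (hij.trans_le h)

theorem mem_filt_of_coef {X : Loop R 𝔤} {d : ℤ} (h : ∀ i j, D.coef X i j ≠ 0 → d ≤ D.deg i j) :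
    X ∈ D.filt R d := fun i j hij => by
  by_contra hne
  exact absurd (h i j hne) (not_le.2 hij)

theorem le_deg_of_mem_filt {X : Loop R 𝔤} {d : ℤ} (hX : X ∈ D.filt R d) {i : ι} {j : ℤ}
    (h : D.coef X i j ≠ 0) : d ≤ D.deg i j := by
  by_contra hlt
  exact h (hX i j (not_le.1 hlt))

theorem lie_mem_filt {X Y : Loop R 𝔤} {d e : ℤ} (hX : X ∈ D.filt R d) (hY : Y ∈ D.filt R e) :
    ⁅X, Y⁆ ∈ D.filt R (d + e) := by
  refine D.mem_filt_of_coef fun l n h => ?_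
  obtain ⟨i, j, a, b, ha, hb, hab⟩ := D.exists_of_coef_lie_ne_zero h
  have := D.le_deg_of_mem_filt hX ha
  have := D.le_deg_of_mem_filt hY hb
  omega

theorem pair_eq_zero_of_mem_filt {X Y : Loop R 𝔤} {d e : ℤ} (hX : X ∈ D.filt R d)
    (hY : Y ∈ D.filt R e) (h : 0 < d + e) : D.pair X Y = 0 := by
  by_contra hne
  obtain ⟨i, j, a, b, ha, hb, hab⟩ := D.exists_of_pair_ne_zero hne
  have := D.le_deg_of_mem_filt hX ha
  have := D.le_deg_of_mem_filt hY hb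
  omega

theorem loopMap_mem_filt (g : R₁ →ₗ[ℂ] R₂) {X : Loop R₁ 𝔤} {d : ℤ} (hX : X ∈ D.filt R₁ d) :
    loopMap 𝔤 g X ∈ D.filt R₂ d := fun i j h => by
  rw [coef_loopMap, hX i j h, map_zero]

theorem eq_zero_of_forall_mem_filt {X : Loop R 𝔤} (h : ∀ n : ℕ, X ∈ D.filt R n) : X = 0 := by
  refine D.ext_coef fun i j => ?_
  rw [h ((D.deg i j).toNat + 1) i j (by omega)]
  exact (map_zero (D.coefₗ R i j)).symm

theorem exists_forall_coef_eq_zero (x : LaurentSeries R) : ∃ a : ℤ, ∀ j < a, x.coeff j = 0 := by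
  refine ⟨x.order, fun j hj => HahnSeries.coeff_eq_zero_of_lt_order hj⟩

theorem exists_mem_filt (X : Loop R 𝔤) : ∃ d, X ∈ D.filt R d := by
  choose a ha using fun i => exists_forall_coef_eq_zero (D.coord X i)
  obtain ⟨A, hA⟩ : ∃ A : ℤ, ∀ i, A ≤ a i := by
    obtain ⟨A, hA⟩ := (Set.finite_range a).bddBelow
    exact ⟨A, fun i => hA ⟨i, rfl⟩⟩
  refine ⟨-D.dd + (D.dd + 2) * A, fun i j h => ha i j ?_⟩
  by_contra! hle
  have h₁ := D.neg_dd_le_wt i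
  have h₂ := D.two_le_dd
  have : (D.dd + 2) * A ≤ (D.dd + 2) * j := by
    have := hA i
    exact mul_le_mul_of_nonneg_left (by omega) (by omega)
  simp only [deg] at h
  omega

/-- Weights are bounded and `z` has positive degree, so a lower bound on degrees bounds the powers
of `z` from below: the degree filtration is compatible with Laurent series. -/
theorem exists_coef_eq (c : ι → ℤ → R) (B : ℤ) (hc : ∀ i j, D.deg i j < B → c i j = 0) :
    ∃ X : Loop R 𝔤, ∀ i j, D.coef X i j = c i j := by
  have hb : ∀ i, BddBelow (Function.support (c i)) := by
    intro i
    -- For `j` below this bound, `(dd + 2) j ≤ j` because `j` is negative, so the degree is at most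
    -- `dd + j < B`.
    refine ⟨min 0 (B - D.dd), fun j hj => ?_⟩
    by_contra! hlt
    refine hj (hc i j ?_)
    have h₁ := D.wt_le i
    have h₂ := D.two_le_dd
    have : (D.dd + 2) * j ≤ 1 * j := by
      apply mul_le_mul_of_nonpos_right <;> omega
    simp only [deg]
    omega
  refine ⟨∑ i, HahnSeries.ofSuppBddBelow (c i) (hb i) ⊗ₜ D.u i, fun i j => ?_⟩
  rw [← coefₗ_apply, map_sum, Finset.sum_eq_single i]
  · simp [coefₗ_apply, coef_tmul]
  · intro l _ hl
    simp [coefₗ_apply, coef_tmul, hl]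
  · simp

theorem sub_mem_filt_of_le {s : ℕ → Loop R 𝔤} {d : ℤ}
    (h : ∀ n : ℕ, s (n + 1) - s n ∈ D.filt R (d + n)) {n n' : ℕ} (hn : n ≤ n') :
    s n' - s n ∈ D.filt R (d + n) := by
  induction n', hn using Nat.le_induction with
  | base => simp
  | succ k hk ih =>
    have := add_mem (D.filt_antitone (by omega) (h k)) ih
    rwa [sub_add_sub_cancel] at this

theorem exists_limit {s : ℕ → Loop R 𝔤} {d : ℤ}
    (h : ∀ n : ℕ, s (n + 1) - s n ∈ D.filt R (d + n)) :
    ∃ X, ∀ n : ℕ, X - s n ∈ D.filt R (d + n) := by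
  obtain ⟨e, he⟩ := D.exists_mem_filt (s 0)
  have hs : ∀ n, s n ∈ D.filt R (min d e) := fun n => by
    have h₁ := D.filt_antitone (min_le_left d e)
      (D.filt_antitone (by simp) (D.sub_mem_filt_of_le h (Nat.zero_le n)))
    simpa using add_mem h₁ (D.filt_antitone (min_le_right d e) he)
  -- The coefficient at `(i, j)` no longer changes once `d + n` exceeds its degree; the index `deg i
  -- j - d + 1` is the first for which this holds, cut off at zero.
  obtain ⟨X, hX⟩ := D.exists_coef_eq
    (fun i j => D.coef (s (D.deg i j - d + 1).toNat) i j) (min d e) (fun i j hij => hs _ i j hij)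
  refine ⟨X, fun n i j hij => ?_⟩
  have hle : (D.deg i j - d + 1).toNat ≤ n := by omega
  have := D.sub_mem_filt_of_le h hle i j (by omega)
  rw [coef_sub] at this ⊢
  rw [hX, ← neg_sub, this, neg_zero]

/-! ### The element `Λ_m` -/

theorem coef_Lam (m : ℕ) (i : ι) (j : ℤ) : D.coef (D.Lam R m) i j =
    -(if j = -(m : ℤ) then algebraMap ℂ R (D.u.repr D.f i) else 0) -
      (if j = -(m : ℤ) - 1 then algebraMap ℂ R (D.u.repr D.p i) else 0) := by
  rw [Lam, coef_sub, ← coefₗ_apply, map_neg, coefₗ_apply, coef_mono, coef_mono]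
  simp [Algebra.algebraMap_eq_smul_one]

theorem deg_eq_of_coef_Lam_ne_zero {m : ℕ} {i : ι} {j : ℤ} (h : D.coef (D.Lam R m) i j ≠ 0) :
    D.deg i j = -D.top m := by
  rw [coef_Lam] at h
  have hf : ⁅D.h, D.f⁆ = ((-2 : ℤ) : ℂ) • D.f := by
    rw [D.triple.lie_h_f_nsmul, two_nsmul]; push_cast; module
  by_cases h₁ : j = -(m : ℤ)
  · have h₂ : j ≠ -(m : ℤ) - 1 := by omega
    have h₃ : D.u.repr D.f i ≠ 0 := by
      intro h0
      rw [if_pos h₁, if_neg h₂, h0] at h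
      simp at h
    rw [deg, D.wt_eq_of_repr_ne_zero hf h₃, top, h₁]
    ring
  · by_cases h₂ : j = -(m : ℤ) - 1
    · have h₃ : D.u.repr D.p i ≠ 0 := by
        intro h0; simp [h₂, h0] at h
      rw [deg, D.wt_eq_of_repr_ne_zero D.p_mem h₃, top, h₂]
      ring
    · simp [h₁, h₂] at h

theorem Lam_mem_filt (m : ℕ) : D.Lam R m ∈ D.filt R (-D.top m) :=
  D.mem_filt_of_coef fun _ _ h => (D.deg_eq_of_coef_Lam_ne_zero h).ge

theorem loopMap_Lam (g : R₁ →ₗ[ℂ] R₂) (hg : g 1 = 1) (m : ℕ) :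
    loopMap 𝔤 g (D.Lam R₁ m) = D.Lam R₂ m := by
  simp [Lam, hg]

theorem top_pos (m : ℕ) : 2 ≤ D.top m := by
  have := D.two_le_dd
  have : 0 ≤ (D.dd + 2) * m := by positivity
  simp only [top]
  omega

/-! ### Powers of `z` -/

theorem coef_nonposPart (X : Loop R 𝔤) (i : ι) (j : ℤ) :
    D.coef (nonposPart R X) i j = if j ≤ 0 then D.coef X i j else 0 := by
  have : D.coefₗ R i j ∘ₗ nonposPart R = if j ≤ 0 then D.coefₗ R i j else 0 := by
    refine TensorProduct.ext' fun x a => ?_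
    have h : (nonposPart R) (x ⊗ₜ[ℂ] a) = (HahnSeries.truncLTLinearMap ℂ (1 : ℤ) x) ⊗ₜ[ℂ] a := rfl
    rw [LinearMap.comp_apply, h, coefₗ_apply, coef_tmul, HahnSeries.coe_truncLTLinearMap,
      HahnSeries.coeff_truncLT]
    split_ifs with h₁ h₂ h₂
    · rw [coefₗ_apply, coef_tmul]
    · omega
    · omega
    · simp
  have := LinearMap.congr_fun this X
  rw [LinearMap.comp_apply, coefₗ_apply] at this
  rw [this]
  split_ifs <;> rfl

theorem coef_posPart (X : Loop R 𝔤) (i : ι) (j : ℤ) :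
    D.coef (posPart R X) i j = if 1 ≤ j then D.coef X i j else 0 := by
  rw [posPart, LinearMap.sub_apply, LinearMap.id_apply, coef_sub, coef_nonposPart]
  split_ifs
  · omega
  · simp
  · simp
  · omega

end Data

/-! ### Formal exponentials through divided powers -/

section DividedPowers

variable {G T : Type*} [AddCommGroup G] [Module ℂ G] [AddCommGroup T] [Module ℂ T]

/-- The divided power `A ^ r / r!`. -/
def dpow (A : Module.End ℂ G) (r : ℕ) : Module.End ℂ G := ((r.factorial : ℂ)⁻¹) • A ^ r

/-- The partial sum of the exponential series of `A`. -/
def expSum (A : Module.End ℂ G) (N : ℕ) : Module.End ℂ G := ∑ r ∈ range N, dpow A r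

@[simp] theorem dpow_zero (A : Module.End ℂ G) : dpow A 0 = 1 := by simp [dpow]

theorem dpow_succ_apply (A : Module.End ℂ G) (r : ℕ) (x : G) :
    ((r : ℂ) + 1) • dpow A (r + 1) x = A (dpow A r x) := by
  have h1 : ((r : ℂ) + 1) ≠ 0 := by exact_mod_cast r.succ_ne_zero
  rw [dpow, dpow, LinearMap.smul_apply, LinearMap.smul_apply, map_smul, smul_smul,
    pow_succ', Module.End.mul_apply]
  congr 1
  rw [Nat.factorial_succ]
  push_cast
  field_simp

theorem expSum_apply (A : Module.End ℂ G) (N : ℕ) (x : G) :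
    expSum A N x = ∑ r ∈ range N, dpow A r x := by simp [expSum]

theorem expSum_succ_apply (A : Module.End ℂ G) (N : ℕ) (x : G) :
    expSum A (N + 1) x = expSum A N x + dpow A N x := by
  rw [expSum_apply, expSum_apply, sum_range_succ]

/-- The homogeneous components of `e^A e^{-A} = 1`, from the binomial theorem for the commuting pair
`A`, `-A`. -/
theorem sum_dpow_dpow_neg (A : Module.End ℂ G) (n : ℕ) (x : G) :
    ∑ ab ∈ antidiagonal n, dpow A ab.1 (dpow (-A) ab.2 x) = if n = 0 then x else 0 := by
  have hc : Commute A (-A) := (Commute.refl A).neg_right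
  have h := hc.add_pow' n
  have h' : ∑ ab ∈ antidiagonal n, dpow A ab.1 (dpow (-A) ab.2 x) =
      ((n.factorial : ℂ)⁻¹) • ((A + -A) ^ n) x := by
    rw [h, LinearMap.sum_apply, smul_sum]
    refine sum_congr rfl fun ab hab => ?_
    rw [HasAntidiagonal.mem_antidiagonal] at hab
    rw [dpow, dpow, LinearMap.smul_apply, LinearMap.smul_apply, map_smul, smul_smul,
      LinearMap.smul_apply, Module.End.mul_apply, ← Nat.cast_smul_eq_nsmul ℂ, smul_smul]
    congr 1
    rw [← hab, Nat.choose_symm_add, Nat.add_choose, Nat.cast_div (Nat.factorial_mul_factorial_dvd_factorial_add _ _)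
      (by exact_mod_cast mul_ne_zero (Nat.factorial_ne_zero _) (Nat.factorial_ne_zero _))]
    have := Nat.factorial_ne_zero (ab.1 + ab.2)
    push_cast
    field_simp
  rw [h', add_neg_cancel]
  split_ifs with h0
  · simp [h0]
  · simp [zero_pow h0]

/-- The exponential of a derivation is multiplicative. In the induction both sides are multiplied by
`r + 1`, and on the right this factor is distributed as the sum of the two indices. -/
theorem dpow_bilinear {U : Type*} [AddCommGroup U] [Module ℂ U] (A : Module.End ℂ G)
    (B : Module.End ℂ T) (C : Module.End ℂ U) (β : G →ₗ[ℂ] T →ₗ[ℂ] U)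
    (h : ∀ g t, C (β g t) = β (A g) t + β g (B t)) (r : ℕ) (g : G) (t : T) :
    dpow C r (β g t) = ∑ ab ∈ antidiagonal r, β (dpow A ab.1 g) (dpow B ab.2 t) := by
  induction r with
  | zero => simp
  | succ r ih =>
    have h1 : ((r : ℂ) + 1) ≠ 0 := by exact_mod_cast r.succ_ne_zero
    rw [← smul_right_inj h1, dpow_succ_apply, ih, map_sum]
    simp only [h, sum_add_distrib]
    have e₁ : ∑ ab ∈ antidiagonal r, β (A (dpow A ab.1 g)) (dpow B ab.2 t) =
        ∑ ab ∈ antidiagonal (r + 1), (ab.1 : ℂ) • β (dpow A ab.1 g) (dpow B ab.2 t) := by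
      rw [Finset.Nat.sum_antidiagonal_succ]
      simp only [← dpow_succ_apply, map_smul, LinearMap.smul_apply]
      simp
    have e₂ : ∑ ab ∈ antidiagonal r, β (dpow A ab.1 g) (B (dpow B ab.2 t)) =
        ∑ ab ∈ antidiagonal (r + 1), (ab.2 : ℂ) • β (dpow A ab.1 g) (dpow B ab.2 t) := by
      rw [Finset.Nat.sum_antidiagonal_succ']
      simp only [← dpow_succ_apply, map_smul]
      simp
    rw [e₁, e₂, ← sum_add_distrib, smul_sum]
    refine sum_congr rfl fun ab hab => ?_
    rw [HasAntidiagonal.mem_antidiagonal] at hab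
    rw [← add_smul]
    congr 1
    exact_mod_cast hab

/-- A product of two truncated exponentials runs over a square, the truncated exponential of a
product over a triangle. The difference involves only total order at least `N`, hence deep
filtration. -/
theorem sum_sum_sub_sum_antidiagonal_mem (F : Submodule ℂ G) (f : ℕ → ℕ → G) (N : ℕ)
    (h : ∀ a b, N ≤ a + b → f a b ∈ F) :
    ∑ a ∈ range N, ∑ b ∈ range N, f a b -
      ∑ r ∈ range N, ∑ ab ∈ antidiagonal r, f ab.1 ab.2 ∈ F := by
  set s := (range N ×ˢ range N).filter fun ab => ab.1 + ab.2 < N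
  have h₁ : ∑ r ∈ range N, ∑ ab ∈ antidiagonal r, f ab.1 ab.2 = ∑ ab ∈ s, f ab.1 ab.2 := by
    rw [← sum_fiberwise_of_maps_to (s := s) (t := range N) (g := fun ab => ab.1 + ab.2)
      (fun x hx => by simpa using (mem_filter.1 hx).2)]
    refine sum_congr rfl fun r hr => sum_congr ?_ fun _ _ => rfl
    ext ab
    simp only [HasAntidiagonal.mem_antidiagonal, s, mem_filter, mem_product, mem_range] at hr ⊢
    omega
  rw [h₁, ← sum_product', ← sum_filter_add_sum_filter_not (range N ×ˢ range N)
    (fun ab => ab.1 + ab.2 < N), add_sub_cancel_left]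
  exact sum_mem fun ab hab => h _ _ (not_lt.1 (mem_filter.1 hab).2)

end DividedPowers

/-! ### Exponentials of `ad S` and the degree filtration -/

namespace Data

variable {ι 𝔤 : Type*} [Fintype ι] [DecidableEq ι] [LieRing 𝔤] [LieAlgebra ℂ 𝔤]
variable (D : Data ι 𝔤)

/-- The operator `ad X` on a loop algebra, over `ℂ`. -/
abbrev adEnd {R : Type*} [CommRing R] [Algebra ℂ R] (X : Loop R 𝔤) : Module.End ℂ (Loop R 𝔤) :=
  LieAlgebra.ad ℂ (Loop R 𝔤) X

/-- The operator `ad S` on `ℂ ∂ ⋉ (ĝ ⊗ 𝒱)`, over `ℂ`. -/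
def adLaxEnd (m : ℕ) (S : Loop (D.V m) 𝔤) : Module.End ℂ (ℂ × Loop (D.V m) 𝔤) where
  toFun := D.adLax m S
  map_add' L L' := by
    simp only [adLax, Prod.fst_add, Prod.snd_add, lie_add, add_smul, Prod.mk_add_mk, add_zero]
    congr 1
    abel
  map_smul' c L := by
    simp only [adLax, Prod.smul_fst, Prod.smul_snd, RingHom.id_apply, Prod.smul_mk, smul_zero,
      smul_sub, smul_assoc, lie_smul]

theorem adLaxEnd_apply (m : ℕ) (S : Loop (D.V m) 𝔤) (L : ℂ × Loop (D.V m) 𝔤) :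
    D.adLaxEnd m S L = D.adLax m S L := rfl

/-- The filtration on `ℂ ∂ ⋉ (ĝ ⊗ 𝒱)` by degree, with `∂` of degree zero. -/
def pairFilt (m : ℕ) (d : ℤ) : Submodule ℂ (ℂ × Loop (D.V m) 𝔤) where
  carrier := {g | (0 < d → g.1 = 0) ∧ g.2 ∈ D.filt (D.V m) d}
  add_mem' hg hg' := ⟨fun h => by rw [Prod.fst_add, hg.1 h, hg'.1 h, add_zero],
    add_mem hg.2 hg'.2⟩
  zero_mem' := ⟨fun _ => rfl, zero_mem _⟩
  smul_mem' c g hg := ⟨fun h => by rw [Prod.smul_fst, hg.1 h, smul_zero],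
    Submodule.smul_mem _ c hg.2⟩

theorem pairFilt_antitone (m : ℕ) {d d' : ℤ} (h : d ≤ d') :
    D.pairFilt m d' ≤ D.pairFilt m d :=
  fun _ hg => ⟨fun h' => hg.1 (h'.trans_le h), D.filt_antitone h hg.2⟩

section Exponential

variable {D} {m : ℕ} {S : Loop (D.V m) 𝔤} (hS : S ∈ D.filt (D.V m) 1)

include hS

theorem adLaxEnd_mem {d : ℤ} {g : ℂ × Loop (D.V m) 𝔤} (hg : g ∈ D.pairFilt m d) :
    D.adLaxEnd m S g ∈ D.pairFilt m (d + 1) := by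
  refine ⟨fun _ => rfl, ?_⟩
  have h₁ : ⁅S, g.2⁆ ∈ D.filt (D.V m) (d + 1) := by
    rw [add_comm]
    exact D.lie_mem_filt hS hg.2
  refine sub_mem h₁ ?_
  by_cases hd : 0 < d
  · rw [hg.1 hd, zero_smul]
    exact zero_mem _
  · exact Submodule.smul_mem _ _ (D.filt_antitone (by omega) (D.loopMap_mem_filt _ hS))

theorem dpow_adLaxEnd_mem {d : ℤ} {g : ℂ × Loop (D.V m) 𝔤} (hg : g ∈ D.pairFilt m d) (r : ℕ) :
    dpow (D.adLaxEnd m S) r g ∈ D.pairFilt m (d + r) := by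
  refine Submodule.smul_mem _ _ ?_
  induction r with
  | zero => simpa using hg
  | succ r ih =>
    rw [pow_succ', Module.End.mul_apply]
    have := adLaxEnd_mem hS ih
    push_cast
    rwa [← add_assoc]

/-- Since `ad S` raises degree by at least one, the tail after `N` terms has degree at least `d +
N`. Coefficientwise stabilization thus amounts to explicit congruences, the form used in all later
arguments. -/
theorem isExpAd_iff {d : ℤ} {L L' : ℂ × Loop (D.V m) 𝔤} (hL : L ∈ D.pairFilt m d) :
    D.IsExpAd m S L L' ↔ ∀ N : ℕ, L' - expSum (D.adLaxEnd m S) N L ∈ D.pairFilt m (d + N) := by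
  have hs : ∀ N : ℕ, ∑ r ∈ Finset.range N, ((r.factorial : ℂ)⁻¹) • ((D.adLax m S)^[r] L).2 =
      (expSum (D.adLaxEnd m S) N L).2 := by
    intro N
    rw [expSum_apply, Prod.snd_sum]
    refine sum_congr rfl fun r _ => ?_
    rw [dpow, LinearMap.smul_apply, Prod.smul_snd, Module.End.pow_apply]
    rfl
  have hmono : ∀ {N N' : ℕ}, N ≤ N' → expSum (D.adLaxEnd m S) N' L -
      expSum (D.adLaxEnd m S) N L ∈ D.pairFilt m (d + N) := by
    intro N N' h
    induction N', h using Nat.le_induction with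
    | base => simp
    | succ k hk ih =>
      rw [expSum_succ_apply, add_sub_right_comm]
      exact add_mem ih (D.pairFilt_antitone m (by omega) (dpow_adLaxEnd_mem hS hL k))
  -- Every value of `ad S` has no `∂` component, so only the term `r = 0` contributes; the empty
  -- partial sum has to be excluded.
  have hfst : ∀ N : ℕ, (expSum (D.adLaxEnd m S) (N + 1) L).1 = L.1 := by
    intro N
    rw [expSum_apply, Prod.fst_sum, sum_range_succ']
    simp only [dpow_zero, Module.End.one_apply, add_eq_right]
    refine sum_eq_zero fun r _ => ?_
    rw [dpow, LinearMap.smul_apply, pow_succ', Module.End.mul_apply, Prod.smul_fst]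
    exact smul_zero _
  constructor
  · rintro ⟨h₁, h₂⟩ N
    refine ⟨fun hN => ?_, fun i j hij => ?_⟩
    · rw [Prod.fst_sub, h₁]
      cases N with
      | zero =>
        rw [hL.1 (by simpa using hN)]
        simp [expSum]
      | succ N => rw [hfst, sub_self]
    · obtain ⟨N', hN', hle⟩ := ((h₂ i j).and (eventually_ge_atTop N)).exists
      rw [hs] at hN'
      have := (hmono hle).2 i j hij
      rw [Prod.snd_sub, coef_sub] at this ⊢
      rw [← hN', this]
  · intro h
    refine ⟨?_, fun i j => ?_⟩
    · have := (h ((-d).toNat + 1)).1 (by omega)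
      rw [Prod.fst_sub, hfst] at this
      exact sub_eq_zero.1 this
    · filter_upwards [eventually_ge_atTop ((D.deg i j - d).toNat + 1)] with N hN
      have := (h N).2 i j (by omega)
      rw [Prod.snd_sub, coef_sub] at this
      rw [hs, sub_eq_zero.1 this]

theorem exists_isExpAd (L : ℂ × Loop (D.V m) 𝔤) : ∃ X, D.IsExpAd m S L (L.1, X) := by
  obtain ⟨d₀, hd₀⟩ := D.exists_mem_filt L.2
  have hL : L ∈ D.pairFilt m (min d₀ 0) :=
    ⟨fun h => by omega, D.filt_antitone (min_le_left _ _) hd₀⟩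
  obtain ⟨X, hX⟩ := D.exists_limit (s := fun N => (expSum (D.adLaxEnd m S) N L).2)
    (d := min d₀ 0) (fun n => by
      rw [← Prod.snd_sub, expSum_succ_apply, add_sub_cancel_left]
      exact (dpow_adLaxEnd_mem hS hL n).2)
  refine ⟨X, rfl, fun i j => ?_⟩
  filter_upwards [eventually_ge_atTop ((D.deg i j - min d₀ 0).toNat + 1)] with N hN
  have := hX N i j (by omega)
  rw [coef_sub] at this
  have h₂ := sub_eq_zero.1 this
  rw [h₂, expSum_apply, Prod.snd_sum]
  congr 1
  refine sum_congr rfl fun r _ => ?_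
  rw [dpow, LinearMap.smul_apply, Prod.smul_snd, Module.End.pow_apply]
  rfl

end Exponential

theorem adEnd_mem {R : Type*} [CommRing R] [Algebra ℂ R] {S X : Loop R 𝔤} {d : ℤ}
    (hS : S ∈ D.filt R 1) (hX : X ∈ D.filt R d) (r : ℕ) :
    dpow (adEnd S) r X ∈ D.filt R (d + r) := by
  refine Submodule.smul_mem _ _ ?_
  induction r with
  | zero => simpa using hX
  | succ r ih =>
    rw [pow_succ', Module.End.mul_apply, LieAlgebra.ad_apply]
    have := D.lie_mem_filt hS ih
    push_cast
    rwa [← add_assoc, add_comm]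

theorem dpow_adLaxEnd_zero (m : ℕ) (S X : Loop (D.V m) 𝔤) (r : ℕ) :
    dpow (D.adLaxEnd m S) r (0, X) = (0, dpow (adEnd S) r X) := by
  rw [dpow, dpow, LinearMap.smul_apply, LinearMap.smul_apply]
  have : (D.adLaxEnd m S ^ r) (0, X) = (0, (adEnd S ^ r) X) := by
    induction r with
    | zero => rfl
    | succ r ih =>
      rw [pow_succ', pow_succ', Module.End.mul_apply, Module.End.mul_apply, ih, adLaxEnd_apply,
        adLax, LieAlgebra.ad_apply]
      simp
  rw [this, Prod.smul_mk, smul_zero]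

theorem expSum_adLaxEnd_zero (m : ℕ) (S X : Loop (D.V m) 𝔤) (N : ℕ) :
    expSum (D.adLaxEnd m S) N (0, X) = (0, expSum (adEnd S) N X) := by
  rw [expSum_apply, expSum_apply]
  simp only [dpow_adLaxEnd_zero]
  ext <;> simp [Prod.fst_sum, Prod.snd_sum]

/-! ### Connections -/

/-- A commutative algebra over `𝒱` with an operator that is compatible with the derivation of `𝒱`. -/
structure Connection (m : ℕ) (R : Type*) [CommRing R] [Algebra ℂ R] where
  base : D.V m →ₐ[ℂ] R
  nabla : R →ₗ[ℂ] R
  leibniz : ∀ r s, nabla (base r * s) = base (D.del m r) * s + base r * nabla s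

variable {D} {m : ℕ} {R : Type*} [CommRing R] [Algebra ℂ R]

namespace Connection

variable (C : Connection D m R)

/-- Base change of loops to `R`. -/
abbrev up : Loop (D.V m) 𝔤 →ₗ[ℂ] Loop R 𝔤 := loopMap 𝔤 C.base.toLinearMap

theorem up_lie (X Y : Loop (D.V m) 𝔤) : C.up ⁅X, Y⁆ = ⁅C.up X, C.up Y⁆ := by
  have := loopMap_lie C.base.toLinearMap LinearMap.id LinearMap.id C.base.toLinearMap 0
    C.base.toLinearMap 0 (by simp) X Y
  simpa using this

theorem nabla_lie (X : Loop (D.V m) 𝔤) (Y : Loop R 𝔤) : loopMap 𝔤 C.nabla ⁅C.up X, Y⁆ =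
    ⁅C.up (D.loopDel m X), Y⁆ + ⁅C.up X, loopMap 𝔤 C.nabla Y⁆ := by
  have := loopMap_lie C.nabla C.base.toLinearMap LinearMap.id
    (C.base.toLinearMap ∘ₗ (D.del m).toLinearMap) C.base.toLinearMap LinearMap.id C.nabla
    C.leibniz X Y
  rw [loopMap_id] at this
  rw [this, up, loopDel, loopMap_loopMap]

/-- The action `c ∂ + X ↦ c ∇ + ad X` of `ℂ ∂ ⋉ (ĝ ⊗ 𝒱)`. -/
def act : (ℂ × Loop (D.V m) 𝔤) →ₗ[ℂ] Loop R 𝔤 →ₗ[ℂ] Loop R 𝔤 :=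
  LinearMap.mk₂ ℂ (fun g Y => g.1 • loopMap 𝔤 C.nabla Y + ⁅C.up g.2, Y⁆)
    (fun g g' Y => by
      simp only [Prod.fst_add, Prod.snd_add, map_add, add_lie, add_smul]; abel)
    (fun c g Y => by
      simp only [Prod.smul_fst, Prod.smul_snd, map_smul, smul_lie, smul_add, smul_assoc])
    (fun g Y Y' => by simp only [map_add, lie_add, smul_add]; abel)
    (fun c g Y => by
      simp only [map_smul, lie_smul, smul_add]
      rw [smul_comm])

theorem act_apply (g : ℂ × Loop (D.V m) 𝔤) (Y : Loop R 𝔤) :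
    C.act g Y = g.1 • loopMap 𝔤 C.nabla Y + ⁅C.up g.2, Y⁆ := rfl

/-- Jacobi for the loop part and the Leibniz rule of `∇` for the `∂` part: `ad S` acts as a
derivation of the action, which is what `dpow_bilinear` requires. -/
theorem lie_act (S : Loop (D.V m) 𝔤) (g : ℂ × Loop (D.V m) 𝔤) (Y : Loop R 𝔤) :
    ⁅C.up S, C.act g Y⁆ = C.act (D.adLaxEnd m S g) Y + C.act g ⁅C.up S, Y⁆ := by
  simp only [act_apply, adLaxEnd_apply, adLax, zero_smul, zero_add, map_sub, map_smul, up_lie,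
    nabla_lie, lie_add, sub_lie, lie_smul, smul_add, smul_lie, lie_lie]
  abel

theorem act_mem {d e : ℤ} {g : ℂ × Loop (D.V m) 𝔤} (hg : g ∈ D.pairFilt m d) {Y : Loop R 𝔤}
    (hY : Y ∈ D.filt R e) : C.act g Y ∈ D.filt R (d + e) := by
  rw [act_apply]
  refine add_mem ?_ (D.lie_mem_filt (D.loopMap_mem_filt _ hg.2) hY)
  by_cases hd : 0 < d
  · rw [hg.1 hd, zero_smul]
    exact zero_mem _
  · exact Submodule.smul_mem _ _ (D.filt_antitone (by omega) (D.loopMap_mem_filt _ hY))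

end Connection

/-- The algebra `𝒱` over itself. -/
def Connection.self (D : Data ι 𝔤) (m : ℕ) : Connection D m (D.V m) where
  base := AlgHom.id ℂ _
  nabla := (D.del m).toLinearMap
  leibniz r s := by
    have := (D.del m).leibniz r s
    simp only [smul_eq_mul] at this
    simp only [AlgHom.coe_id, id_eq, Derivation.coeFn_coe, this]
    ring

theorem Connection.self_up (X : Loop (D.V m) 𝔤) : (Connection.self D m).up X = X :=
  loopMap_id X

/-- Injectivity of `e^{ad S}`: the terms with `r ≥ 1` lie deeper than `Z` itself, so `Z` can be
pushed one degree further at each step, and the filtration is separated. -/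
theorem eq_zero_of_expSum_mem {S Z : Loop R 𝔤} (hS : S ∈ D.filt R 1) {c : ℤ}
    (h : ∀ N : ℕ, 0 < N → expSum (adEnd S) N Z ∈ D.filt R (c + N)) : Z = 0 := by
  have key : ∀ n : ℕ, Z ∈ D.filt R (c + (n + 1)) := by
    intro n
    induction n with
    | zero => simpa [expSum] using h 1 one_pos
    | succ n ih =>
      have h₁ := h (n + 2) (by omega)
      rw [expSum_apply, sum_range_succ', dpow_zero, Module.End.one_apply] at h₁
      have h₂ : ∑ r ∈ range (n + 1), dpow (adEnd S) (r + 1) Z ∈ D.filt R (c + (n + 2)) :=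
        sum_mem fun r _ => D.filt_antitone (by push_cast; omega) (D.adEnd_mem hS ih (r + 1))
      have h₃ := sub_mem h₁ h₂
      rw [add_sub_cancel_left] at h₃
      exact D.filt_antitone (by push_cast; omega) h₃
  exact D.eq_zero_of_forall_mem_filt fun n =>
    D.filt_antitone (by omega) (key (n + (-c).toNat))

/-- The truncated form of `e^{ad S} e^{-ad S} b = b`. -/
theorem expSum_sub_mem_of_isExpAd_neg {S b M : Loop (D.V m) 𝔤} (hS : S ∈ D.filt (D.V m) 1)
    {e : ℤ} (hb : b ∈ D.filt (D.V m) e) (hM : D.IsExpAd m (-S) (0, b) (0, M)) {N : ℕ} (hN : 0 < N) :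
    expSum (adEnd S) N M - b ∈ D.filt (D.V m) (e + N) := by
  have hneg : adEnd (-S) = -adEnd S := map_neg _ _
  have hb' : ((0 : ℂ), b) ∈ D.pairFilt m e := ⟨fun _ => rfl, hb⟩
  have hM' : M - expSum (adEnd (-S)) N b ∈ D.filt (D.V m) (e + N) := by
    have := ((isExpAd_iff (neg_mem hS) hb').1 hM N).2
    rwa [expSum_adLaxEnd_zero] at this
  have h₁ : expSum (adEnd S) N (M - expSum (adEnd (-S)) N b) ∈ D.filt (D.V m) (e + N) := by
    rw [expSum_apply]
    exact sum_mem fun r _ => D.filt_antitone (by omega) (D.adEnd_mem hS hM' r)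
  have h₂ := sum_sum_sub_sum_antidiagonal_mem (D.filt (D.V m) (e + N))
    (fun r s => dpow (adEnd S) r (dpow (adEnd (-S)) s b)) N (fun r s hrs => by
      have := D.adEnd_mem hS (D.adEnd_mem (neg_mem hS) hb s) r
      exact D.filt_antitone (by omega) this)
  have h₃ : ∑ r ∈ range N, ∑ ab ∈ antidiagonal r,
      dpow (adEnd S) ab.1 (dpow (adEnd (-S)) ab.2 b) = b := by
    rw [hneg]
    simp only [sum_dpow_dpow_neg]
    rw [sum_ite_eq' (range N) 0 (fun _ => b), if_pos (mem_range.2 hN)]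
  rw [h₃] at h₂
  have h₄ : ∑ r ∈ range N, ∑ s ∈ range N, dpow (adEnd S) r (dpow (adEnd (-S)) s b) =
      expSum (adEnd S) N (expSum (adEnd (-S)) N b) := by
    simp only [expSum_apply, map_sum]
    rw [sum_comm]
  rw [h₄] at h₂
  have := add_mem h₁ h₂
  rwa [map_sub, sub_add_sub_cancel] at this

/-- Modulo deep filtration `e^{ad S} [L, M] = [e^{ad S} L, e^{ad S} M] = [L', b] = 0`, and `e^{ad
S}` is injective. -/
theorem act_eq_zero_of_isExpAd {S b M : Loop (D.V m) 𝔤} {L L' : ℂ × Loop (D.V m) 𝔤}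
    (hS : S ∈ D.filt (D.V m) 1) (hL : D.IsExpAd m S L L') (hM : D.IsExpAd m (-S) (0, b) (0, M))
    (h : (Connection.self D m).act L' b = 0) : (Connection.self D m).act L M = 0 := by
  set C := Connection.self D m
  obtain ⟨d₀, hd₀⟩ := D.exists_mem_filt L.2
  obtain ⟨e₀, he₀⟩ := D.exists_mem_filt b
  obtain ⟨e₁, he₁⟩ := D.exists_mem_filt M
  set d := min d₀ 0
  set e := min e₀ e₁
  have hLd : L ∈ D.pairFilt m d := ⟨fun h => by omega, D.filt_antitone (min_le_left _ _) hd₀⟩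
  have hbe : b ∈ D.filt (D.V m) e := D.filt_antitone (min_le_left _ _) he₀
  have hMe : M ∈ D.filt (D.V m) e := D.filt_antitone (min_le_right _ _) he₁
  have hLN := (isExpAd_iff hS hLd).1 hL
  have hL'd : L' ∈ D.pairFilt m d := by simpa [expSum] using hLN 0
  refine eq_zero_of_expSum_mem hS (c := d + e) fun N hN => ?_
  have hleib : ∀ g Y, adEnd S (C.act g Y) = C.act (D.adLaxEnd m S g) Y + C.act g (adEnd S Y) := by
    intro g Y
    have := C.lie_act S g Y
    rwa [Connection.self_up] at this
  have h₁ := sum_sum_sub_sum_antidiagonal_mem (D.filt (D.V m) (d + e + N))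
    (fun r s => C.act (dpow (D.adLaxEnd m S) r L) (dpow (adEnd S) s M)) N (fun r s hrs => by
      have := C.act_mem (dpow_adLaxEnd_mem hS hLd r) (D.adEnd_mem hS hMe s)
      exact D.filt_antitone (by omega) this)
  have h₂ : expSum (adEnd S) N (C.act L M) = ∑ r ∈ range N, ∑ ab ∈ antidiagonal r,
      C.act (dpow (D.adLaxEnd m S) ab.1 L) (dpow (adEnd S) ab.2 M) := by
    rw [expSum_apply]
    exact sum_congr rfl fun r _ => dpow_bilinear _ _ _ C.act hleib r L M
  have h₃ : ∑ r ∈ range N, ∑ s ∈ range N,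
      C.act (dpow (D.adLaxEnd m S) r L) (dpow (adEnd S) s M) =
      C.act (expSum (D.adLaxEnd m S) N L) (expSum (adEnd S) N M) := by
    simp only [expSum_apply, map_sum, LinearMap.sum_apply]
    rw [sum_comm]
  have h₅ : expSum (adEnd S) N M ∈ D.filt (D.V m) e := by
    rw [expSum_apply]
    exact sum_mem fun r _ => D.filt_antitone (by omega) (D.adEnd_mem hS hMe r)
  have h₆ : C.act (expSum (D.adLaxEnd m S) N L) (expSum (adEnd S) N M) ∈
      D.filt (D.V m) (d + e + N) := by
    have e₁ := C.act_mem (hLN N) h₅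
    have e₂ := C.act_mem hL'd (expSum_sub_mem_of_isExpAd_neg hS hbe hM hN)
    rw [map_sub, h, sub_zero] at e₂
    rw [map_sub, LinearMap.sub_apply] at e₁
    have := sub_mem (D.filt_antitone (by omega) e₂ : _ ∈ D.filt (D.V m) (d + e + N))
      (D.filt_antitone (by omega) e₁)
    rwa [sub_sub_cancel] at this
  rw [← h₂, h₃] at h₁
  have := sub_mem h₆ h₁
  rwa [sub_sub_cancel] at this

end Data

/-! ### Differentiating a gauge transformation -/

namespace Data

variable {ι 𝔤 : Type*} [Fintype ι] [DecidableEq ι] [LieRing 𝔤] [LieAlgebra ℂ 𝔤]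
variable {D : Data ι 𝔤} {m : ℕ} {R : Type*} [CommRing R] [Algebra ℂ R]

/-- The inclusion `b ↦ b ⊗ 1` with coefficients in `R`. -/
abbrev const (R : Type*) [CommRing R] [Algebra ℂ R] (b : Loop ℂ 𝔤) : Loop R 𝔤 :=
  loopMap 𝔤 (Algebra.linearMap ℂ R) b

theorem pair_dpow_adEnd (S X Y : Loop R 𝔤) (r : ℕ) :
    D.pair X (dpow (adEnd S) r Y) = D.pair (dpow (adEnd (-S)) r X) Y := by
  simp only [← pairing_apply, dpow, LinearMap.smul_apply, map_smul]
  congr 1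
  induction r generalizing X with
  | zero => rfl
  | succ r ih =>
    rw [pow_succ', pow_succ, Module.End.mul_apply, Module.End.mul_apply, ← ih, pairing_apply,
      LieAlgebra.ad_apply, ← pair_lie, LieAlgebra.ad_apply, neg_lie, lie_skew, pairing_apply]

namespace Connection

variable (C : Connection D m R)

theorem up_incl (b : Loop ℂ 𝔤) : C.up (D.incl m b) = const R b := by
  rw [up, incl, loopMap_loopMap]
  congr 2
  ext
  simp

theorem up_dpow (S X : Loop (D.V m) 𝔤) (r : ℕ) :
    C.up (dpow (adEnd S) r X) = dpow (adEnd (C.up S)) r (C.up X) := by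
  rw [dpow, dpow, LinearMap.smul_apply, LinearMap.smul_apply, map_smul]
  congr 1
  induction r with
  | zero => rfl
  | succ r ih =>
    rw [pow_succ', pow_succ', Module.End.mul_apply, Module.End.mul_apply, ← ih,
      LieAlgebra.ad_apply, LieAlgebra.ad_apply, up_lie]

theorem pair_const_nabla (b : Loop ℂ 𝔤) (Y : Loop R 𝔤) :
    D.pair (const R b) (loopMap 𝔤 C.nabla Y) = C.nabla (D.pair (const R b) Y) := by
  have := D.map_pair C.nabla (Algebra.linearMap ℂ R) LinearMap.id (Algebra.linearMap ℂ R) 0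
    C.nabla 0 (fun r s => by simp [← Algebra.smul_def]) b Y
  rw [loopMap_id] at this
  rw [this]
  simp [pair]

/-- A derivation from `𝒱` to `R` that intertwines `∂` with `∇`. -/
structure Variation (C : Connection D m R) where
  toLin : D.V m →ₗ[ℂ] R
  leibniz : ∀ r s, toLin (r * s) = toLin r * C.base s + C.base r * toLin s
  comm : ∀ r, toLin (D.del m r) = C.nabla (toLin r)

namespace Variation

variable {C} (T : C.Variation)

/-- Coefficientwise application of a variation. -/
abbrev d : Loop (D.V m) 𝔤 →ₗ[ℂ] Loop R 𝔤 := loopMap 𝔤 T.toLin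

theorem d_lie (X Y : Loop (D.V m) 𝔤) : T.d ⁅X, Y⁆ = ⁅T.d X, C.up Y⁆ + ⁅C.up X, T.d Y⁆ := by
  have := loopMap_lie T.toLin LinearMap.id LinearMap.id T.toLin C.base.toLinearMap
    C.base.toLinearMap T.toLin T.leibniz X Y
  rwa [loopMap_id, loopMap_id] at this

theorem d_loopDel (X : Loop (D.V m) 𝔤) : T.d (D.loopDel m X) = loopMap 𝔤 C.nabla (T.d X) := by
  rw [d, loopDel, loopMap_loopMap, loopMap_loopMap]
  congr 2
  exact LinearMap.ext T.comm

/-- The derivative of `[S, g]` is `[S, dg] + [dS, g]`. The symbol `∂` is constant under `d`, and the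
second bracket is minus the action of `g` on `dS`. -/
theorem d_adLaxEnd (S : Loop (D.V m) 𝔤) (g : ℂ × Loop (D.V m) 𝔤) :
    T.d (D.adLaxEnd m S g).2 = adEnd (C.up S) (T.d g.2) - C.act g (T.d S) := by
  rw [adLaxEnd_apply, adLax, map_sub, map_smul, d_lie, d_loopDel, act_apply, LieAlgebra.ad_apply,
    ← lie_skew (C.up g.2)]
  abel

/-- The terms of the series `∑ (ad S) ^ n (dS) / (n + 1)!`. -/
def series (S : Loop (D.V m) 𝔤) (n : ℕ) : Loop R 𝔤 :=
  ((n : ℂ) + 1)⁻¹ • dpow (adEnd (C.up S)) n (T.d S)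

theorem adEnd_series (S : Loop (D.V m) 𝔤) (n : ℕ) :
    adEnd (C.up S) (T.series S n) = ((n : ℂ) + 2) • T.series S (n + 1) := by
  have h1 : ((n : ℂ) + 1) ≠ 0 := by exact_mod_cast n.succ_ne_zero
  have h2 : ((n : ℂ) + 2) ≠ 0 := by exact_mod_cast (n + 1).succ_ne_zero
  rw [series, map_smul, ← dpow_succ_apply, smul_smul, inv_mul_cancel₀ h1, one_smul, series,
    smul_smul]
  push_cast
  rw [add_assoc, one_add_one_eq_two, mul_inv_cancel₀ h2, one_smul]

theorem series_zero (S : Loop (D.V m) 𝔤) : T.series S 0 = T.d S := by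
  simp [series]

/-- The component of order `r + 1` of `d(e^{ad S} g) = e^{ad S} dg - [e^{ad S} g, ∑ (ad S)^n dS / (n
+ 1)!]`. The weights `1 / (n + 1)!` are the ones that close the induction: the contributions `a` and
`b + 1` add up to `r + 2` on the antidiagonal `a + b = r + 1`. -/
theorem d_dpow_succ (S : Loop (D.V m) 𝔤) (g : ℂ × Loop (D.V m) 𝔤) (r : ℕ) :
    T.d (dpow (D.adLaxEnd m S) (r + 1) g).2 = dpow (adEnd (C.up S)) (r + 1) (T.d g.2) -
      ∑ ab ∈ antidiagonal r, C.act (dpow (D.adLaxEnd m S) ab.1 g) (T.series S ab.2) := by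
  induction r with
  | zero =>
    have h1 := dpow_succ_apply (D.adLaxEnd m S) 0 g
    have h2 := dpow_succ_apply (adEnd (C.up S)) 0 (T.d g.2)
    simp only [Nat.cast_zero, zero_add, one_smul, dpow_zero, Module.End.one_apply] at h1 h2
    simp [h1, h2, d_adLaxEnd, series_zero]
  | succ r ih =>
    have h1 : (((r + 1 : ℕ) : ℂ) + 1) ≠ 0 := by exact_mod_cast (r + 1).succ_ne_zero
    rw [← smul_right_inj h1, ← map_smul, ← Prod.smul_snd, dpow_succ_apply, d_adLaxEnd, ih,
      smul_sub, dpow_succ_apply, map_sub, sub_sub]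
    congr 1
    rw [map_sum]
    have hl : ∀ ab : ℕ × ℕ, adEnd (C.up S)
        (C.act (dpow (D.adLaxEnd m S) ab.1 g) (T.series S ab.2)) =
        ((ab.1 : ℂ) + 1) • C.act (dpow (D.adLaxEnd m S) (ab.1 + 1) g) (T.series S ab.2) +
        ((ab.2 : ℂ) + 2) • C.act (dpow (D.adLaxEnd m S) ab.1 g) (T.series S (ab.2 + 1)) := by
      intro ab
      rw [LieAlgebra.ad_apply, lie_act, ← dpow_succ_apply, ← LieAlgebra.ad_apply ℂ, adEnd_series,
        map_smul, map_smul, LinearMap.smul_apply]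
    simp only [hl, sum_add_distrib]
    have e₁ : ∑ ab ∈ antidiagonal r,
        ((ab.1 : ℂ) + 1) • C.act (dpow (D.adLaxEnd m S) (ab.1 + 1) g) (T.series S ab.2) =
        ∑ ab ∈ antidiagonal (r + 1),
          (ab.1 : ℂ) • C.act (dpow (D.adLaxEnd m S) ab.1 g) (T.series S ab.2) := by
      rw [Finset.Nat.sum_antidiagonal_succ]
      simp
    have e₂ : ∑ ab ∈ antidiagonal r,
        ((ab.2 : ℂ) + 2) • C.act (dpow (D.adLaxEnd m S) ab.1 g) (T.series S (ab.2 + 1)) +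
          C.act (dpow (D.adLaxEnd m S) (r + 1) g) (T.d S) =
        ∑ ab ∈ antidiagonal (r + 1),
          ((ab.2 : ℂ) + 1) • C.act (dpow (D.adLaxEnd m S) ab.1 g) (T.series S ab.2) := by
      rw [Finset.Nat.sum_antidiagonal_succ', series_zero, Nat.cast_zero, zero_add, one_smul,
        add_comm]
      congr 1
      refine sum_congr rfl fun ab _ => ?_
      push_cast
      rw [add_assoc, one_add_one_eq_two]
    rw [add_assoc, e₁, e₂, ← sum_add_distrib, smul_sum]
    refine sum_congr rfl fun ab hab => ?_
    rw [HasAntidiagonal.mem_antidiagonal] at hab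
    rw [← add_smul, ← hab]
    congr 1
    push_cast
    ring

theorem series_mem {S : Loop (D.V m) 𝔤} (hS : S ∈ D.filt (D.V m) 1) (n : ℕ) :
    T.series S n ∈ D.filt R (1 + n) :=
  Submodule.smul_mem _ _ (D.adEnd_mem (D.loopMap_mem_filt _ hS) (D.loopMap_mem_filt _ hS) n)

/-- Conjugation changes the first variation only by a total derivative: the term coming from `dS` is
a commutator with `L'`, and `b` commutes with `L'`. The map `τ` stands for integration, and
invariance moves `e^{ad S}` from `dL` onto `b`, turning it into `M`. -/
theorem apply_pair_const_d {S M : Loop (D.V m) 𝔤} {L L' : ℂ × Loop (D.V m) 𝔤}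
    {b : Loop ℂ 𝔤} (hS : S ∈ D.filt (D.V m) 1) (hL : D.IsExpAd m S L L')
    (hM : D.IsExpAd m (-S) (0, D.incl m b) (0, M)) (hb : ⁅D.incl m b, L'.2⁆ = 0)
    {E : Type*} [AddCommGroup E] [Module ℂ E] (τ : R →ₗ[ℂ] E) (hτ : ∀ r, τ (C.nabla r) = 0) :
    τ (D.pair (const R b) (T.d L'.2)) = τ (D.pair (C.up M) (T.d L.2)) := by
  obtain ⟨d₀, hd₀⟩ := D.exists_mem_filt L.2
  obtain ⟨e, he⟩ := D.exists_mem_filt b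
  set d := min d₀ 0
  have hX : L.2 ∈ D.filt (D.V m) d := D.filt_antitone (min_le_left _ _) hd₀
  have hLd : L ∈ D.pairFilt m d := ⟨fun h => by omega, hX⟩
  have hLN := (isExpAd_iff hS hLd).1 hL
  have hL'd : L' ∈ D.pairFilt m d := by simpa [expSum] using hLN 0
  have hbe : D.incl m b ∈ D.filt (D.V m) e := D.loopMap_mem_filt _ he
  have hbR : const R b ∈ D.filt R e := D.loopMap_mem_filt _ he
  have hb' : ((0 : ℂ), D.incl m b) ∈ D.pairFilt m e := ⟨fun _ => rfl, hbe⟩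
  have hMN := (isExpAd_iff (neg_mem hS) hb').1 hM
  -- From this order on, all neglected terms have positive total degree with `b`, so the pairing
  -- annihilates them and the truncated identities become exact.
  set N : ℕ := (-(d + e)).toNat + 1
  have hN : 0 < d + e + N := by omega
  have h₁ : D.pair (const R b) (T.d L'.2) =
      D.pair (const R b) (T.d (expSum (D.adLaxEnd m S) (N + 1) L).2) := by
    rw [← sub_eq_zero, ← pairing_apply, ← pairing_apply, ← map_sub, ← map_sub, ← Prod.snd_sub]
    exact D.pair_eq_zero_of_mem_filt hbR (D.loopMap_mem_filt _ (hLN (N + 1)).2)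
      (by push_cast; omega)
  have h₂ : D.pair (C.up M) (T.d L.2) =
      D.pair (const R b) (expSum (adEnd (C.up S)) (N + 1) (T.d L.2)) := by
    have h₃ := D.loopMap_mem_filt C.base.toLinearMap (hMN (N + 1)).2
    rw [expSum_adLaxEnd_zero] at h₃
    have h₄ : C.up (expSum (adEnd (-S)) (N + 1) (D.incl m b)) =
        expSum (adEnd (-C.up S)) (N + 1) (const R b) := by
      rw [expSum_apply, expSum_apply, map_sum, ← up_incl C]
      exact sum_congr rfl fun r _ => by rw [up_dpow, map_neg]
    have h₅ : D.pair (const R b) (expSum (adEnd (C.up S)) (N + 1) (T.d L.2)) =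
        D.pair (expSum (adEnd (-C.up S)) (N + 1) (const R b)) (T.d L.2) := by
      rw [expSum_apply, expSum_apply, ← pairing_apply, ← pairing_apply, map_sum, map_sum,
        LinearMap.sum_apply]
      exact sum_congr rfl fun r _ => pair_dpow_adEnd _ _ _ r
    rw [h₅, ← h₄, ← sub_eq_zero, ← pairing_apply, ← pairing_apply, ← LinearMap.sub_apply,
      ← map_sub, ← map_sub]
    exact D.pair_eq_zero_of_mem_filt h₃ (D.loopMap_mem_filt _ hX) (by push_cast; omega)
  have h₆ : ∀ K : ℕ, T.d (expSum (D.adLaxEnd m S) (K + 1) L).2 =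
      expSum (adEnd (C.up S)) (K + 1) (T.d L.2) - ∑ r ∈ range K, ∑ ab ∈ antidiagonal r,
        C.act (dpow (D.adLaxEnd m S) ab.1 L) (T.series S ab.2) := by
    intro K
    rw [expSum_apply, expSum_apply, Prod.snd_sum, map_sum, sum_range_succ' _ K,
      sum_range_succ' _ K]
    simp only [d_dpow_succ, dpow_zero, Module.End.one_apply, sum_sub_distrib]
    abel
  have h₇ : D.pair (const R b) (∑ r ∈ range N, ∑ ab ∈ antidiagonal r,
        C.act (dpow (D.adLaxEnd m S) ab.1 L) (T.series S ab.2)) =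
      D.pair (const R b) (C.act L' (∑ n ∈ range N, T.series S n)) := by
    have e₁ := sum_sum_sub_sum_antidiagonal_mem (D.filt R (d + N))
      (fun r s => C.act (dpow (D.adLaxEnd m S) r L) (T.series S s)) N (fun r s hrs => by
        have := C.act_mem (dpow_adLaxEnd_mem hS hLd r) (T.series_mem hS s)
        exact D.filt_antitone (by omega) this)
    have e₂ : ∑ r ∈ range N, ∑ s ∈ range N, C.act (dpow (D.adLaxEnd m S) r L) (T.series S s) =
        C.act (expSum (D.adLaxEnd m S) N L) (∑ n ∈ range N, T.series S n) := by
      simp only [expSum_apply, map_sum, LinearMap.sum_apply]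
      rw [sum_comm]
    have e₃ : ∑ n ∈ range N, T.series S n ∈ D.filt R 0 :=
      sum_mem fun n _ => D.filt_antitone (by omega) (T.series_mem hS n)
    have e₄ := C.act_mem (hLN N) e₃
    rw [map_sub, LinearMap.sub_apply, add_zero] at e₄
    rw [e₂] at e₁
    have e₅ := add_mem e₄ e₁
    rw [sub_add_sub_cancel] at e₅
    have := D.pair_eq_zero_of_mem_filt hbR e₅ (by omega)
    rw [← pairing_apply, map_sub, sub_eq_zero] at this
    exact this.symm
  -- After moving `ad L'` onto `b` only the `∇` summand survives; as `b` is constant, it is a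
  -- multiple of `∇ (b, Y)`.
  have h₈ : ∀ Y, τ (D.pair (const R b) (C.act L' Y)) = 0 := by
    intro Y
    rw [act_apply, pair_add_right, ← pair_lie, ← up_incl C, ← up_lie, hb, map_zero, up_incl,
      ← pairing_apply, ← pairing_apply, map_smul, map_zero, LinearMap.zero_apply, add_zero,
      pairing_apply, pair_const_nabla, map_smul, hτ, smul_zero]
  rw [h₁, h₂, h₆, ← pairing_apply, map_sub, map_sub, pairing_apply, pairing_apply, h₇, h₈, sub_zero]

end Variation

end Connection

/-! ### Splitting off the kernel of `ad Λ_m` -/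

/-- The image of `ad Λ_m` has an invariant complement. On it `ad Λ_m` takes values both in the
complement and in the image, hence vanishes, so kernel and image span. -/
theorem exists_lie_sub_lie_eq_zero
    (hss : (LieAlgebra.ad (LaurentSeries ℂ) (Loop ℂ 𝔤) (D.Lam ℂ m)).IsSemisimple)
    (x : Loop ℂ 𝔤) : ∃ w : Loop ℂ 𝔤, ⁅D.Lam ℂ m, x - ⁅D.Lam ℂ m, w⁆⁆ = 0 := by
  set A := LieAlgebra.ad (LaurentSeries ℂ) (Loop ℂ 𝔤) (D.Lam ℂ m)
  have hr : LinearMap.range A ∈ Module.End.invtSubmodule A := by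
    rw [Module.End.mem_invtSubmodule]
    rintro _ ⟨y, rfl⟩
    exact ⟨A y, rfl⟩
  obtain ⟨q, hq, hc⟩ := (Module.End.isSemisimple_iff.1 hss) _ hr
  obtain ⟨_, ⟨w, rfl⟩, c, hcq, hx⟩ := Submodule.mem_sup.1
    (hc.sup_eq_top ▸ Submodule.mem_top : x ∈ LinearMap.range A ⊔ q)
  refine ⟨w, ?_⟩
  have h₁ : x - ⁅D.Lam ℂ m, w⁆ = c := by
    rw [← hx]
    exact add_sub_cancel_left _ _
  rw [h₁]
  have h₂ : A c ∈ LinearMap.range A ⊓ q := ⟨⟨c, rfl⟩, hq hcq⟩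
  rw [hc.inf_eq_bot] at h₂
  exact h₂

theorem coef_lie_Lam_eq_zero {X : Loop R 𝔤} {c : ℤ} (hX : ∀ i j, c ≤ D.deg i j → D.coef X i j = 0)
    (i : ι) (j : ℤ) (h : c - D.top m ≤ D.deg i j) : D.coef ⁅D.Lam R m, X⁆ i j = 0 := by
  by_contra hne
  obtain ⟨i', j', a, b, ha, hb, hab⟩ := D.exists_of_coef_lie_ne_zero hne
  refine hb (hX _ _ ?_)
  have := D.deg_eq_of_coef_Lam_ne_zero ha
  omega

/-- Homogeneity of `Λ_m` permits discarding the components of `w` of degree below `d + top`. They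
alter `[Λ_m, x - [Λ_m, w]]` only in degrees below `d - top`, where the truncated expression vanishes
by the degrees of its constituents. -/
theorem exists_mem_filt_lie_sub_lie_eq_zero
    (hss : (LieAlgebra.ad (LaurentSeries ℂ) (Loop ℂ 𝔤) (D.Lam ℂ m)).IsSemisimple)
    {d : ℤ} {x : Loop ℂ 𝔤} (hx : x ∈ D.filt ℂ d) :
    ∃ w ∈ D.filt ℂ (d + D.top m), ⁅D.Lam ℂ m, x - ⁅D.Lam ℂ m, w⁆⁆ = 0 := by
  obtain ⟨w, hw⟩ := exists_lie_sub_lie_eq_zero hss x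
  obtain ⟨w', hw'⟩ := D.exists_coef_eq
    (fun i j => if D.deg i j < d + D.top m then 0 else D.coef w i j) (d + D.top m)
    (fun i j h => if_pos h)
  have hmem : w' ∈ D.filt ℂ (d + D.top m) := fun i j h => by rw [hw', if_pos h]
  refine ⟨w', hmem, ?_⟩
  have h₁ : ∀ i j, d + D.top m ≤ D.deg i j → D.coef (w - w') i j = 0 := fun i j h => by
    rw [coef_sub, hw', if_neg (not_lt.2 h), sub_self]
  have h₂ : ⁅D.Lam ℂ m, x - ⁅D.Lam ℂ m, w'⁆⁆ = ⁅D.Lam ℂ m, ⁅D.Lam ℂ m, w - w'⁆⁆ := by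
    rw [← sub_zero ⁅D.Lam ℂ m, x - ⁅D.Lam ℂ m, w'⁆⁆, ← hw, ← lie_sub, sub_sub_sub_cancel_left,
      ← lie_sub]
  have h₃ : ⁅D.Lam ℂ m, x - ⁅D.Lam ℂ m, w'⁆⁆ ∈ D.filt ℂ (-D.top m + d) := by
    refine D.lie_mem_filt (D.Lam_mem_filt m) (sub_mem hx ?_)
    exact D.filt_antitone (by omega) (D.lie_mem_filt (D.Lam_mem_filt m) hmem)
  refine D.ext_coef fun i j => ?_
  rw [show D.coef (0 : Loop ℂ 𝔤) i j = 0 from map_zero (D.coefₗ ℂ i j)]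
  by_cases hd : D.deg i j < -D.top m + d
  · exact h₃ i j hd
  · rw [h₂]
    exact coef_lie_Lam_eq_zero (coef_lie_Lam_eq_zero h₁) i j (by omega)

theorem coord_smul (s : LaurentSeries R) (X : Loop R 𝔤) (i : ι) :
    D.coord (s • X) i = s * D.coord X i := by
  simp [coord]

theorem const_lie (X Y : Loop ℂ 𝔤) : const R ⁅X, Y⁆ = ⁅const R X, const R Y⁆ := by
  have := loopMap_lie (Algebra.linearMap ℂ R) LinearMap.id LinearMap.id (Algebra.linearMap ℂ R) 0
    (Algebra.linearMap ℂ R) 0 (by simp) X Y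
  simpa using this

/-- The equation is linear over Laurent series with coefficients in `R`, so it suffices to solve it
for each constant basis vector `u i` over `ℂ`; the degree bound is inherited from these solutions.
-/
theorem exists_solution
    (hss : (LieAlgebra.ad (LaurentSeries ℂ) (Loop ℂ 𝔤) (D.Lam ℂ m)).IsSemisimple)
    {d : ℤ} {X : Loop R 𝔤} (hX : X ∈ D.filt R d) :
    ∃ Y ∈ D.filt R (d + D.top m), ⁅D.Lam R m, X - ⁅D.Lam R m, Y⁆⁆ = 0 := by
  have hu : ∀ i, (mono (D.u i) 0 1 : Loop ℂ 𝔤) ∈ D.filt ℂ (D.wt i) := fun i =>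
    D.mem_filt_of_coef fun l n h => by
      rw [coef_mono] at h
      have hn : n = 0 := by
        by_contra hn
        exact h (if_neg hn)
      have hl : l = i := by
        by_contra hl
        refine h ?_
        rw [Module.Basis.repr_self, Finsupp.single_eq_of_ne hl, zero_smul, ite_self]
      rw [hn, hl, deg, mul_zero, add_zero]
  choose w hw hw' using fun i => exists_mem_filt_lie_sub_lie_eq_zero hss (hu i)
  have hΛ : const R (D.Lam ℂ m) = D.Lam R m := D.loopMap_Lam _ (by simp) m
  refine ⟨∑ i, D.coord X i • const R (w i), sum_mem fun i _ => ?_, ?_⟩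
  · refine D.mem_filt_of_coef fun l n h => ?_
    rw [coef_eq, coord_smul] at h
    obtain ⟨a, b, hab, ha, hb⟩ := exists_coeff_of_coeff_mul_ne_zero h
    have h₁ := D.le_deg_of_mem_filt hX (i := i) (j := a) ha
    have h₂ := D.le_deg_of_mem_filt (D.loopMap_mem_filt _ (hw i)) (i := l) (j := b) hb
    rw [← hab, add_comm a b, deg_add]
    simp only [deg] at h₁ h₂ ⊢
    omega
  · have h₁ : X = ∑ i, D.coord X i • const R (mono (D.u i) 0 1) := by
      conv_lhs => rw [← D.sum_coord X]
      refine sum_congr rfl fun i _ => ?_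
      rw [show const R (mono (D.u i) 0 1 : Loop ℂ 𝔤) = mono (D.u i) 0 _ from loopMap_mono _ _ _ _,
        mono, TensorProduct.smul_tmul', smul_eq_mul]
      congr 1
      simp
    generalize D.coord X = c at h₁
    rw [h₁, lie_sum, ← sum_sub_distrib, lie_sum]
    refine sum_eq_zero fun i _ => ?_
    rw [lie_smul, ← smul_sub, lie_smul, ← hΛ, ← const_lie, ← map_sub, ← const_lie, hw',
      show const R (0 : Loop ℂ 𝔤) = 0 from map_zero _, smul_zero]

/-! ### Gauge diagonalization -/

theorem lax_sub_Lam_mem (D : Data ι 𝔤) (m : ℕ) :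
    D.lax m - D.Lam (D.V m) m ∈ D.filt (D.V m) (1 - D.top m) := by
  rw [lax, add_sub_cancel_right]
  refine sum_mem fun x _ => D.mem_filt_of_coef fun i j h => ?_
  have hx := x.2
  rw [coef_mono] at h
  have hj : j = -((x.1.2 : ℕ) : ℤ) := by
    by_contra hj
    exact h (if_neg hj)
  rw [if_pos hj] at h
  -- The dual vector `ũ_i` has weight opposite to `u_i`, so `ũ_i z^{-j}` has degree `-deg u_i z^j`,
  -- which exceeds `-top` exactly on the index set.
  have hw : D.wt i = -D.wt x.1.1 := by
    have hut : ⁅D.h, D.ut x.1.1⁆ = ((-D.wt x.1.1 : ℤ) : ℂ) • D.ut x.1.1 := by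
      have hsep : ∀ a : 𝔤, (∀ j, D.form (D.u j) a = 0) → a = 0 := by
        intro a ha
        have hrepr : ∀ j, D.form (D.u j) a = D.ut.repr a j := by
          intro j
          conv_lhs => rw [← D.ut.sum_repr a]
          rw [map_sum, sum_eq_single j]
          · simp [D.dual]
          · intro l _ hl
            simp [D.dual, hl.symm]
          · simp
        refine D.ut.repr.map_eq_zero_iff.1 ?_
        ext j
        rw [← hrepr, ha]
        rfl
      rw [← sub_eq_zero]
      refine hsep _ fun j => ?_
      have h₁ := D.form_inv (D.u j) D.h (D.ut x.1.1)
      rw [← lie_skew, D.lie_h_u, map_neg, map_smul, LinearMap.neg_apply, LinearMap.smul_apply,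
        D.dual] at h₁
      rw [map_sub, map_smul, ← h₁, D.dual]
      split_ifs with hjx
      · rw [hjx]; push_cast; simp
      · simp
    exact D.wt_eq_of_repr_ne_zero hut (left_ne_zero_of_smul h)
  simp only [deg] at hx ⊢
  rw [hw, hj, mul_neg]
  omega

/-- First-order perturbation: replacing `S` by `S + T` changes `e^{ad S}(k∂ + X)` in lowest degree
only through `[T, Λ_m]`. All other terms contain a further factor of positive degree, or `X - Λ_m`,
or `∂T`. -/
theorem expSum_sub_expSum_mem {S T : Loop (D.V m) 𝔤} {k : ℂ} {X : Loop (D.V m) 𝔤} {n : ℤ}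
    (hn : 1 ≤ n) (hS : S ∈ D.filt (D.V m) 1) (hT : T ∈ D.filt (D.V m) n)
    (hX : X - D.Lam (D.V m) m ∈ D.filt (D.V m) (1 - D.top m)) (N : ℕ) :
    (expSum (D.adLaxEnd m (S + T)) (N + 2) (k, X)).2 - (expSum (D.adLaxEnd m S) (N + 2) (k, X)).2 -
      ⁅T, D.Lam (D.V m) m⁆ ∈ D.filt (D.V m) (n + 1 - D.top m) := by
  have htop := D.top_pos m
  have hST : S + T ∈ D.filt (D.V m) 1 := add_mem hS (D.filt_antitone hn hT)
  have hX' : X ∈ D.filt (D.V m) (-D.top m) := by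
    have := add_mem (D.filt_antitone (by omega) hX) (D.Lam_mem_filt (R := D.V m) m)
    rwa [sub_add_cancel] at this
  have hg : ((k, X) : ℂ × Loop (D.V m) 𝔤) ∈ D.pairFilt m (-D.top m) :=
    ⟨fun h => by omega, hX'⟩
  have hone : (D.adLaxEnd m (S + T) (k, X)).2 - (D.adLaxEnd m S (k, X)).2 =
      ⁅T, X⁆ - k • D.loopDel m T := by
    simp only [adLaxEnd_apply, adLax, add_lie, map_add, smul_add]
    abel
  have hTX : ⁅T, X⁆ - k • D.loopDel m T ∈ D.filt (D.V m) (n - D.top m) :=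
    sub_mem (D.lie_mem_filt hT hX')
      (Submodule.smul_mem _ _ (D.filt_antitone (by omega) (D.loopMap_mem_filt _ hT)))
  have hpow : ∀ r : ℕ, ((D.adLaxEnd m (S + T) ^ (r + 1)) (k, X)).2 -
      ((D.adLaxEnd m S ^ (r + 1)) (k, X)).2 ∈ D.filt (D.V m) (n - D.top m + r) := by
    intro r
    induction r with
    | zero =>
      rw [zero_add, pow_one, pow_one, hone]
      simpa using hTX
    | succ r ih =>
      have hz : ∀ U : Loop (D.V m) 𝔤, ((D.adLaxEnd m U ^ (r + 1)) (k, X)).1 = 0 := by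
        intro U
        rw [pow_succ', Module.End.mul_apply]
        rfl
      have hS' : ((D.adLaxEnd m S ^ (r + 1)) (k, X)).2 ∈ D.filt (D.V m) (-D.top m + (r + 1)) := by
        have := (dpow_adLaxEnd_mem hS hg (r + 1)).2
        rw [dpow, LinearMap.smul_apply, Prod.smul_snd] at this
        have h₁ := Submodule.smul_mem _ ((r + 1).factorial : ℂ) this
        rw [smul_inv_smul₀ (by exact_mod_cast Nat.factorial_ne_zero _)] at h₁
        exact_mod_cast h₁
      have e : ((D.adLaxEnd m (S + T) ^ (r + 1 + 1)) (k, X)).2 -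
          ((D.adLaxEnd m S ^ (r + 1 + 1)) (k, X)).2 =
          ⁅S + T, ((D.adLaxEnd m (S + T) ^ (r + 1)) (k, X)).2 -
            ((D.adLaxEnd m S ^ (r + 1)) (k, X)).2⁆ + ⁅T, ((D.adLaxEnd m S ^ (r + 1)) (k, X)).2⁆ := by
        rw [pow_succ' _ (r + 1), pow_succ' _ (r + 1), Module.End.mul_apply, Module.End.mul_apply,
          adLaxEnd_apply, adLaxEnd_apply, adLax, adLax, hz, hz]
        simp only [zero_smul, sub_zero, lie_sub, add_lie]
        abel
      rw [e]
      refine add_mem ?_ ?_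
      · exact D.filt_antitone (by push_cast; omega) (D.lie_mem_filt hST ih)
      · exact D.filt_antitone (by push_cast; omega) (D.lie_mem_filt hT hS')
  -- The terms of order zero cancel and those of order one are computed by `hone`, so at least two
  -- terms must be present.
  have hsplit : (expSum (D.adLaxEnd m (S + T)) (N + 2) (k, X)).2 -
      (expSum (D.adLaxEnd m S) (N + 2) (k, X)).2 =
      ∑ r ∈ range N, (((r + 2).factorial : ℂ)⁻¹) • (((D.adLaxEnd m (S + T) ^ (r + 2)) (k, X)).2 -
      ((D.adLaxEnd m S ^ (r + 2)) (k, X)).2) + (⁅T, X⁆ - k • D.loopDel m T) := by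
    rw [expSum_apply, expSum_apply, Prod.snd_sum, Prod.snd_sum, ← sum_sub_distrib,
      sum_range_succ', sum_range_succ', ← hone]
    simp [dpow, smul_sub]
  rw [hsplit, add_sub_assoc (Finset.sum _ _)]
  refine add_mem (sum_mem fun r _ => Submodule.smul_mem _ _ ?_) ?_
  · exact D.filt_antitone (by push_cast; omega) (hpow (r + 1))
  · rw [sub_right_comm, ← lie_sub]
    refine sub_mem ?_ ?_
    · exact D.filt_antitone (by omega) (D.lie_mem_filt hT hX)
    · exact Submodule.smul_mem _ _ (D.filt_antitone (by omega) (D.loopMap_mem_filt _ hT))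

theorem expAd_sub_expAd_mem {S T X Z Z' : Loop (D.V m) 𝔤} {k : ℂ} {n : ℤ}
    (hn : 1 ≤ n) (hS : S ∈ D.filt (D.V m) 1) (hT : T ∈ D.filt (D.V m) n)
    (hX : X - D.Lam (D.V m) m ∈ D.filt (D.V m) (1 - D.top m))
    (hZ : D.IsExpAd m S (k, X) (k, Z)) (hZ' : D.IsExpAd m (S + T) (k, X) (k, Z')) :
    Z' - Z - ⁅T, D.Lam (D.V m) m⁆ ∈ D.filt (D.V m) (n + 1 - D.top m) := by
  have htop := D.top_pos m
  have hST : S + T ∈ D.filt (D.V m) 1 := add_mem hS (D.filt_antitone hn hT)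
  have hX' : X ∈ D.filt (D.V m) (-D.top m) := by
    have := add_mem (D.filt_antitone (by omega) hX) (D.Lam_mem_filt (R := D.V m) m)
    rwa [sub_add_cancel] at this
  have hg : ((k, X) : ℂ × Loop (D.V m) 𝔤) ∈ D.pairFilt m (-D.top m) :=
    ⟨fun h => by omega, hX'⟩
  have h₁ := ((isExpAd_iff hS hg).1 hZ (n.toNat + 1 + 2)).2
  have h₂ := ((isExpAd_iff hST hg).1 hZ' (n.toNat + 1 + 2)).2
  have h₃ := expSum_sub_expSum_mem (k := k) hn hS hT hX (n.toNat + 1)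
  rw [Prod.snd_sub] at h₁ h₂
  have h₄ := add_mem (D.filt_antitone (by push_cast; omega) (sub_mem h₂ h₁)) h₃
  convert h₄ using 1
  abel

/-- `S` diagonalizes the operator `k ∂ + X` up to terms of degree at least `n - top m`. -/
def DiagUpTo (k : ℂ) (X : Loop (D.V m) 𝔤) (n : ℕ) (S : Loop (D.V m) 𝔤) : Prop :=
  S ∈ D.filt (D.V m) 1 ∧ ∃ Z H, D.IsExpAd m S (k, X) (k, Z) ∧ ⁅D.Lam (D.V m) m, H⁆ = 0 ∧
    Z - D.Lam (D.V m) m - H ∈ D.filt (D.V m) (n + 1 - D.top m)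

/-- Adding `Y` to `S` subtracts `[Λ_m, Y]` from the remainder up to higher degree. By the choice of
`Y`, what is left of the old remainder lies in the kernel and is absorbed into `H`. -/
theorem DiagUpTo.exists_succ {k : ℂ} {X S : Loop (D.V m) 𝔤} {n : ℕ}
    (hss : (LieAlgebra.ad (LaurentSeries ℂ) (Loop ℂ 𝔤) (D.Lam ℂ m)).IsSemisimple)
    (hX : X - D.Lam (D.V m) m ∈ D.filt (D.V m) (1 - D.top m)) (h : DiagUpTo k X n S) :
    ∃ S', DiagUpTo k X (n + 1) S' ∧ S' - S ∈ D.filt (D.V m) (n + 1) := by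
  obtain ⟨hS, Z, H, hZ, hH, hmem⟩ := h
  obtain ⟨Y, hY, hsol⟩ := exists_solution hss hmem
  rw [sub_add_cancel] at hY
  have hSY : S + Y ∈ D.filt (D.V m) 1 := add_mem hS (D.filt_antitone (by omega) hY)
  obtain ⟨Z', hZ'⟩ := exists_isExpAd hSY (k, X)
  refine ⟨S + Y, ⟨hSY, Z', H + (Z - D.Lam (D.V m) m - H - ⁅D.Lam (D.V m) m, Y⁆), hZ', ?_, ?_⟩, ?_⟩
  · rw [lie_add, hH, hsol, add_zero]
  · have := expAd_sub_expAd_mem (by omega) hS hY hX hZ hZ'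
    rw [← lie_skew] at this
    push_cast
    convert this using 1
    abel
  · rwa [add_sub_cancel_left]

theorem exists_isDiag
    (hss : (LieAlgebra.ad (LaurentSeries ℂ) (Loop ℂ 𝔤) (D.Lam ℂ m)).IsSemisimple) (k : ℂ) :
    ∃ S H, D.IsDiag k m S H := by
  have hX := D.lax_sub_Lam_mem m
  have h0 : DiagUpTo k (D.lax m) 0 0 := by
    refine ⟨zero_mem _, ?_⟩
    obtain ⟨Z, hZ⟩ := exists_isExpAd (zero_mem (D.filt (D.V m) 1)) (k, D.lax m)
    refine ⟨Z, 0, hZ, lie_zero _, ?_⟩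
    obtain ⟨d, hd⟩ := D.exists_mem_filt (D.lax m)
    have hz : ∀ r : ℕ, dpow (D.adLaxEnd m 0) (r + 1) (k, D.lax m) = 0 := by
      intro r
      have : D.adLaxEnd m 0 = 0 := by
        ext1
        all_goals
          refine LinearMap.ext fun x => ?_
          simp [adLaxEnd_apply, adLax]
      rw [dpow, this, zero_pow r.succ_ne_zero, smul_zero, LinearMap.zero_apply]
    have hZ' : Z = D.lax m := by
      refine D.ext_coef fun i j => ?_
      have hg : ((k, D.lax m) : ℂ × Loop (D.V m) 𝔤) ∈ D.pairFilt m (min d 0) :=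
        ⟨fun h => by omega, D.filt_antitone (min_le_left _ _) hd⟩
      have := ((isExpAd_iff (zero_mem _) hg).1 hZ ((D.deg i j - min d 0).toNat + 1)).2 i j
        (by omega)
      rw [expSum_apply, sum_range_succ'] at this
      simp only [hz, sum_const_zero, dpow_zero, Module.End.one_apply, zero_add, Prod.snd_sub,
        coef_sub] at this
      exact sub_eq_zero.1 this
    rw [hZ', sub_zero]
    simpa using hX
  choose! next hnext hnext' using fun (n : ℕ) (S : Loop (D.V m) 𝔤) (h : DiagUpTo k (D.lax m) n S) =>
    h.exists_succ hss hX
  let s : ℕ → Loop (D.V m) 𝔤 := fun n => Nat.rec 0 (fun n S => next n S) n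
  have hs : ∀ n, DiagUpTo k (D.lax m) n (s n) := by
    intro n
    induction n with
    | zero => exact h0
    | succ n ih => exact hnext n _ ih
  obtain ⟨S, hSlim⟩ := D.exists_limit (s := s) (d := 1) (fun n => by
    rw [add_comm]; exact hnext' n _ (hs n))
  have hS : S ∈ D.filt (D.V m) 1 := by simpa [s] using hSlim 0
  obtain ⟨Z, hZ⟩ := exists_isExpAd hS (k, D.lax m)
  refine ⟨S, Z - D.Lam (D.V m) m, fun i j h => hS i j (by omega), ?_, ?_⟩
  · refine D.eq_zero_of_forall_mem_filt fun n => ?_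
    -- The comparison with stage `N` is valid up to degree `1 + N - top`, and bracketing with `Λ_m`
    -- costs another `top`.
    set N := n + (2 * D.top m).toNat
    obtain ⟨hsN, Z', H, hZ', hH, hmem⟩ := hs N
    have hT := hSlim N
    rw [← add_sub_cancel (s N) S] at hZ
    have h₁ := expAd_sub_expAd_mem (by omega) hsN hT hX hZ' hZ
    have h₂ : ⁅S - s N, D.Lam (D.V m) m⁆ ∈ D.filt (D.V m) (1 + N - D.top m) :=
      D.lie_mem_filt hT (D.Lam_mem_filt m)
    have h₃ : Z - D.Lam (D.V m) m - H ∈ D.filt (D.V m) (1 + N - D.top m) := by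
      have h₄ := add_mem (add_mem (D.filt_antitone (by omega) h₁) h₂)
        (D.filt_antitone (by omega) hmem)
      convert h₄ using 1
      abel
    have h₅ := D.lie_mem_filt (D.Lam_mem_filt (R := D.V m) m) h₃
    rw [lie_sub, hH, sub_zero] at h₅
    have := D.top_pos m
    exact D.filt_antitone (by omega) h₅
  · rwa [add_sub_cancel]

end Data

namespace Data

variable {ι 𝔤 : Type*} [Fintype ι] [DecidableEq ι] [LieRing 𝔤] [LieAlgebra ℂ 𝔤]
variable {D : Data ι 𝔤} {m : ℕ}

/-! ### The operator `λ + ∂` -/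

theorem coeff_lamDel (P : Polynomial (D.V m)) (n : ℕ) :
    (D.lamDel m P).coeff n = (Polynomial.X * P).coeff n + D.del m (P.coeff n) := by
  rw [lamDel, Polynomial.coeff_add, Polynomial.sum_def, Polynomial.finsetSum_coeff]
  congr 1
  simp only [Polynomial.coeff_monomial]
  rw [sum_ite_eq' P.support n]
  split_ifs with h
  · rfl
  · rw [Polynomial.notMem_support_iff.1 h, map_zero]

variable (D m) in
/-- The operator `λ + ∂` as a linear map. -/
def lamDelₗ : Polynomial (D.V m) →ₗ[ℂ] Polynomial (D.V m) where
  toFun := D.lamDel m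
  map_add' P P' := by
    ext1 n
    simp only [coeff_lamDel, Polynomial.coeff_add, mul_add, map_add]
    abel
  map_smul' c P := by
    ext1 n
    simp only [coeff_lamDel, Polynomial.coeff_smul, mul_smul_comm, RingHom.id_apply, smul_add]
    rw [Derivation.map_smul]

theorem lamDel_C_mul (r : D.V m) (P : Polynomial (D.V m)) : D.lamDel m (Polynomial.C r * P) =
    Polynomial.C (D.del m r) * P + Polynomial.C r * D.lamDel m P := by
  ext1 n
  simp only [coeff_lamDel, Polynomial.coeff_add, Polynomial.coeff_C_mul, Derivation.leibniz,
    smul_eq_mul]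
  rw [show Polynomial.X * (Polynomial.C r * P) = Polynomial.C r * (Polynomial.X * P) by ring,
    Polynomial.coeff_C_mul]
  ring

theorem lamDel_monomial (n : ℕ) (c : D.V m) : D.lamDel m (Polynomial.monomial n c) =
    Polynomial.monomial (n + 1) c + Polynomial.monomial n (D.del m c) := by
  rw [lamDel, Polynomial.sum_monomial_index _ _ (by simp), Polynomial.X_mul_monomial]

variable (D m) in
/-- The algebra `𝒱[λ]` with the operator `λ + ∂`. -/
def lamConnection : Connection D m (Polynomial (D.V m)) where
  base := Polynomial.CAlgHom
  nabla := D.lamDelₗ m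
  leibniz r s := lamDel_C_mul r s

/-- The symbol `∑ (∂φ / ∂u_x^{(l)}) λ ^ l` of the Fréchet derivative in the direction `x`. -/
def symbol (x : D.Idx m) : Derivation ℂ (D.V m) (Polynomial (D.V m)) :=
  MvPolynomial.mkDerivation ℂ fun y => if y.1 = x then Polynomial.X ^ y.2 else 0

theorem symbol_X (x : D.Idx m) (y : D.Idx m × ℕ) :
    symbol x (MvPolynomial.X y) = if y.1 = x then Polynomial.X ^ y.2 else 0 :=
  MvPolynomial.mkDerivation_X ..

theorem del_X (y : D.Idx m × ℕ) :
    D.del m (MvPolynomial.X y) = MvPolynomial.X (y.1, y.2 + 1) :=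
  MvPolynomial.mkDerivation_X ..

theorem symbol_mul (x : D.Idx m) (r s : D.V m) : symbol x (r * s) =
    symbol x r * Polynomial.C s + Polynomial.C r * symbol x s := by
  rw [Derivation.leibniz, Polynomial.smul_eq_C_mul, Polynomial.smul_eq_C_mul]
  ring

theorem compDer_apply {M N : Type*} [AddCommGroup M] [Module ℂ M] [Module (D.V m) M]
    [IsScalarTower ℂ (D.V m) M] [AddCommGroup N] [Module ℂ N] [Module (D.V m) N]
    [IsScalarTower ℂ (D.V m) N] (f : M →ₗ[D.V m] N) (d : Derivation ℂ (D.V m) M) (φ : D.V m) :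
    f.compDer d φ = f (d φ) := rfl

theorem lamDel_add (P P' : Polynomial (D.V m)) :
    D.lamDel m (P + P') = D.lamDel m P + D.lamDel m P' := map_add (D.lamDelₗ m) P P'

/-- On the variable `u_x^{(n)}`, applying `∂` multiplies the symbol by `λ`; on products the
remaining `∂` differentiates the coefficients. -/
theorem symbol_del (x : D.Idx m) (r : D.V m) :
    symbol x (D.del m r) = D.lamDel m (symbol x r) := by
  induction r using MvPolynomial.induction_on with
  | C c =>
    have h : D.del m (MvPolynomial.C c) = 0 := MvPolynomial.derivation_C ..
    have h' : symbol x (MvPolynomial.C c) = 0 := MvPolynomial.derivation_C ..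
    rw [h, h', map_zero]
    exact (map_zero (D.lamDelₗ m)).symm
  | add p q hp hq => rw [map_add, map_add, hp, hq, map_add, lamDel_add]
  | mul_X p y hp =>
    have hX : symbol x (D.del m (MvPolynomial.X y)) =
        D.lamDel m (symbol x (MvPolynomial.X y)) := by
      rw [del_X, symbol_X, symbol_X]
      by_cases h : y.1 = x
      · rw [if_pos h, if_pos h, ← Polynomial.monomial_one_right_eq_X_pow,
          ← Polynomial.monomial_one_right_eq_X_pow, lamDel_monomial, Derivation.map_one_eq_zero,
          map_zero, add_zero]
      · rw [if_neg h, if_neg h]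
        exact (map_zero (D.lamDelₗ m)).symm
    have hd : D.del m (p * MvPolynomial.X y) =
        D.del m p * MvPolynomial.X y + p * D.del m (MvPolynomial.X y) := by
      rw [Derivation.leibniz, smul_eq_mul, smul_eq_mul]
      ring
    rw [hd, map_add, symbol_mul, symbol_mul, symbol_mul, hp, hX, lamDel_add,
      mul_comm (symbol x p) (Polynomial.C (MvPolynomial.X y)), lamDel_C_mul, lamDel_C_mul]
    ring

/-- The Fréchet derivative in the direction `x` as a variation. -/
def symbolVariation (x : D.Idx m) : (D.lamConnection m).Variation where
  toLin := (symbol x : D.V m →ₗ[ℂ] Polynomial (D.V m))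
  leibniz := symbol_mul x
  comm := symbol_del x

/-- The map `∑ c_n λ ^ n ↦ ∑ (-∂) ^ n c_n`. -/
def adjointAtZero (D : Data ι 𝔤) (m : ℕ) : Polynomial (D.V m) →ₗ[ℂ] D.V m :=
  Polynomial.lsum fun n => (-(D.del m : D.V m →ₗ[ℂ] D.V m)) ^ n

theorem adjointAtZero_monomial (n : ℕ) (c : D.V m) : adjointAtZero D m (Polynomial.monomial n c) =
    ((-(D.del m : D.V m →ₗ[ℂ] D.V m) : Module.End ℂ (D.V m)) ^ n) c := by
  rw [adjointAtZero, Polynomial.lsum_apply]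
  exact Polynomial.sum_monomial_index c
    (fun n c => ((-(D.del m : D.V m →ₗ[ℂ] D.V m) : Module.End ℂ (D.V m)) ^ n) c) (map_zero _)

/-- Total derivatives have no variational derivative: `λ^{n+1} c` and `λ^n ∂c` are sent to opposite
elements. -/
theorem adjointAtZero_lamDel (P : Polynomial (D.V m)) :
    adjointAtZero D m (D.lamDel m P) = 0 := by
  induction P using Polynomial.induction_on' with
  | add P Q hP hQ => rw [lamDel_add, map_add, hP, hQ, add_zero]
  | monomial n c =>
    rw [lamDel_monomial, map_add, adjointAtZero_monomial, adjointAtZero_monomial, pow_succ,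
      Module.End.mul_apply, LinearMap.neg_apply, map_neg]
    exact neg_add_cancel _

/-! ### Evaluation at `λ = 0` -/

theorem eval_zero_lamDel (P : Polynomial (D.V m)) :
    (D.lamDel m P).eval 0 = D.del m (P.eval 0) := by
  rw [← Polynomial.coeff_zero_eq_eval_zero, coeff_lamDel, Polynomial.mul_coeff_zero,
    Polynomial.coeff_X_zero, zero_mul, zero_add, Polynomial.coeff_zero_eq_eval_zero]

theorem eval_zero_iterate_lamDel (n : ℕ) (P : Polynomial (D.V m)) :
    ((D.lamDel m)^[n] P).eval 0 = (D.del m)^[n] (P.eval 0) := by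
  induction n with
  | zero => rfl
  | succ n ih =>
    rw [Function.iterate_succ_apply', eval_zero_lamDel, ih, Function.iterate_succ_apply']

/-- The value `P(∂) r = ∑ c_n ∂ ^ n r` for `P = ∑ c_n λ ^ n`. -/
def opAt (r : D.V m) : Polynomial (D.V m) →ₗ[D.V m] D.V m :=
  Polynomial.lsum fun n => LinearMap.toSpanSingleton (D.V m) (D.V m) ((D.del m)^[n] r)

theorem opAt_apply (r : D.V m) (P : Polynomial (D.V m)) :
    opAt r P = P.sum fun n c => c * (D.del m)^[n] r := rfl

theorem opAt_monomial (r : D.V m) (n : ℕ) (c : D.V m) :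
    opAt r (Polynomial.monomial n c) = c * (D.del m)^[n] r := by
  rw [opAt_apply, Polynomial.sum_monomial_index c (fun n c => c * (D.del m)^[n] r) (zero_mul _)]

theorem opAt_C (r c : D.V m) : opAt r (Polynomial.C c) = c * r := opAt_monomial r 0 c

theorem opAt_C_mul_X (r c : D.V m) :
    opAt r (Polynomial.C c * Polynomial.X) = c * D.del m r := by
  rw [Polynomial.C_mul_X_eq_monomial, opAt_monomial]
  rfl

theorem opAt_lamDel (r : D.V m) (P : Polynomial (D.V m)) :
    opAt r (D.lamDel m P) = D.del m (opAt r P) := by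
  induction P using Polynomial.induction_on' with
  | add P Q hP hQ => rw [lamDel_add, map_add, hP, hQ, map_add, map_add]
  | monomial n c =>
    rw [lamDel_monomial, map_add, opAt_monomial, opAt_monomial, opAt_monomial, Derivation.leibniz,
      Function.iterate_succ_apply', smul_eq_mul, smul_eq_mul, mul_comm (D.del m c)]

theorem opAt_iterate_lamDel (r : D.V m) (n : ℕ) (P : Polynomial (D.V m)) :
    opAt r ((D.lamDel m)^[n] P) = (D.del m)^[n] (opAt r P) := by
  induction n with
  | zero => rfl
  | succ n ih => rw [Function.iterate_succ_apply', opAt_lamDel, ih, Function.iterate_succ_apply']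

theorem eval_zero_arrow (P F : Polynomial (D.V m)) :
    (D.arrow m P F).eval 0 = opAt (F.eval 0) P := by
  rw [arrow, Polynomial.sum_def, Polynomial.eval_finsetSum, opAt_apply, Polynomial.sum_def]
  simp only [Polynomial.eval_mul, Polynomial.eval_C, eval_zero_iterate_lamDel]

/-- The evolutionary derivation with characteristic `ρ`. -/
def evo (ρ : D.Idx m → D.V m) : Derivation ℂ (D.V m) (D.V m) :=
  MvPolynomial.mkDerivation ℂ fun y => (D.del m)^[y.2] (ρ y.1)

theorem evo_X (ρ : D.Idx m → D.V m) (y : D.Idx m × ℕ) :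
    evo ρ (MvPolynomial.X y) = (D.del m)^[y.2] (ρ y.1) :=
  MvPolynomial.mkDerivation_X ..

theorem evo_add (ρ ρ' : D.Idx m → D.V m) : evo (ρ + ρ') = evo ρ + evo ρ' :=
  MvPolynomial.derivation_ext fun y => by
    rw [Derivation.add_apply, evo_X, evo_X, evo_X, Pi.add_apply, iterate_map_add]

theorem evo_zero : evo (0 : D.Idx m → D.V m) = 0 :=
  MvPolynomial.derivation_ext fun y => by
    rw [evo_X, Pi.zero_apply, iterate_map_zero, Derivation.zero_apply]

theorem evo_neg (ρ : D.Idx m → D.V m) : evo (-ρ) = -evo ρ := by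
  rw [eq_neg_iff_add_eq_zero, ← evo_add, neg_add_cancel, evo_zero]

theorem evo_sum {κ : Type*} (s : Finset κ) (ρ : κ → D.Idx m → D.V m) :
    evo (∑ i ∈ s, ρ i) = ∑ i ∈ s, evo (ρ i) := by
  classical
  induction s using Finset.induction_on with
  | empty => simp [evo_zero]
  | insert a s ha ih => rw [sum_insert ha, sum_insert ha, evo_add, ih]

/-- The variational derivative with respect to the variable `x`. -/
def varDer (x : D.Idx m) (φ : D.V m) : D.V m := adjointAtZero D m (symbol x φ)

theorem coeff_symbol (x : D.Idx m) (l : ℕ) (φ : D.V m) :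
    (symbol x φ).coeff l = MvPolynomial.pderiv (x, l) φ := by
  have : (Polynomial.lcoeff (D.V m) l).compDer (symbol x) = MvPolynomial.pderiv (x, l) := by
    refine MvPolynomial.derivation_ext fun y => ?_
    rw [compDer_apply, Polynomial.lcoeff_apply, symbol_X, MvPolynomial.pderiv_X]
    by_cases h : y.1 = x
    · rw [if_pos h, Polynomial.coeff_X_pow]
      by_cases hl : l = y.2
      · rw [if_pos hl, show y = (x, l) from Prod.ext h hl.symm, Pi.single_eq_same]
      · rw [if_neg hl, Pi.single_eq_of_ne]
        intro hy
        exact hl (by rw [hy])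
    · rw [if_neg h, Polynomial.coeff_zero, Pi.single_eq_of_ne]
      intro hy
      exact h (by rw [hy])
  exact congrArg (fun d : Derivation ℂ (D.V m) (D.V m) => d φ) this

theorem eval_zero_iterate_neg_lamDel (n : ℕ) (c : D.V m) :
    ((fun F => -D.lamDel m F)^[n] (Polynomial.C c)).eval 0 =
      ((-(D.del m : D.V m →ₗ[ℂ] D.V m) : Module.End ℂ (D.V m)) ^ n) c := by
  induction n with
  | zero => simp
  | succ n ih =>
    rw [Function.iterate_succ_apply', Polynomial.eval_neg, eval_zero_lamDel, ih, pow_succ',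
      Module.End.mul_apply]
    rfl

theorem eval_zero_finsum_eq_varDer (x : D.Idx m) (φ : D.V m) :
    (∑ᶠ l : ℕ, (fun F => -D.lamDel m F)^[l]
        (Polynomial.C (MvPolynomial.pderiv (x, l) φ))).eval 0 = varDer x φ := by
  -- Only finitely many derivatives of a variable occur in `φ`, so the `finsum` is an honest finite
  -- sum and not the default value zero.
  have hsupp : Function.support (fun l : ℕ => (fun F => -D.lamDel m F)^[l]
      (Polynomial.C (MvPolynomial.pderiv (x, l) φ))) ⊆ ((symbol x φ).support : Set ℕ) := by
    intro l hl
    rw [Finset.mem_coe, Polynomial.mem_support_iff, coeff_symbol]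
    intro h0
    refine hl ?_
    simp only [h0, Polynomial.C_0]
    have : ∀ n : ℕ, (fun F => -D.lamDel m F)^[n] 0 = 0 := fun n => by
      induction n with
      | zero => rfl
      | succ n ih =>
        rw [Function.iterate_succ_apply', ih, show D.lamDel m 0 = 0 from map_zero (D.lamDelₗ m),
          neg_zero]
    exact this l
  rw [finsum_eq_sum_of_support_subset _ hsupp, Polynomial.eval_finsetSum, varDer, adjointAtZero,
    Polynomial.lsum_apply, Polynomial.sum_def]
  refine sum_congr rfl fun l _ => ?_
  rw [eval_zero_iterate_neg_lamDel, coeff_symbol]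

/-- Evaluation at `λ = 0` is linear over `𝒱` and turns `λ + ∂` into `∂`, so both sides are
derivations in `ψ` and only need comparison on variables. -/
theorem eval_zero_lamBracket (B : D.Idx m → D.Idx m → Polynomial (D.V m)) (φ ψ : D.V m) :
    (D.lamBracket m B φ ψ).eval 0 = evo (fun y => ∑ x, opAt (varDer x φ) (B x y)) ψ := by
  have : (Polynomial.leval (0 : D.V m)).compDer (MvPolynomial.mkDerivation ℂ
      (fun y : D.Idx m × ℕ => (D.lamDel m)^[y.2] (∑ x : D.Idx m, D.arrow m (B x y.1)
        (∑ᶠ l : ℕ, (fun F => -D.lamDel m F)^[l]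
          (Polynomial.C (MvPolynomial.pderiv (x, l) φ)))))) =
      evo (fun y => ∑ x, opAt (varDer x φ) (B x y)) := by
    refine MvPolynomial.derivation_ext fun y => ?_
    rw [compDer_apply, MvPolynomial.mkDerivation_X, evo_X]
    change Polynomial.eval 0 _ = _
    rw [eval_zero_iterate_lamDel, Polynomial.eval_finsetSum]
    simp only [eval_zero_arrow, eval_zero_finsum_eq_varDer]
  exact congrArg (fun d : Derivation ℂ (D.V m) (D.V m) => d ψ) this

/-- The gauge action of `n z ^ 0 ⊗ r` on the generators. -/
def gaugeChar (k : ℂ) (n : 𝔤) (r : D.V m) (y : D.Idx m) : D.V m :=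
  D.cls m ⁅n, D.u y.1.1⁆ (y.1.2 : ℕ) * r +
    if (y.1.2 : ℕ) = 0 then MvPolynomial.C (k * D.form n (D.u y.1.1)) * D.del m r else 0

/-- The infinitesimal gauge transformation with parameter `n ⊗ r` is `ad_λ n` followed by the
substitution `λ^l ↦ ∂^l r`. -/
theorem evo_gaugeChar_eq_zero {k : ℂ} {φ : D.V m} (hφ : φ ∈ D.W k m) {n : 𝔤} (hn : D.IsNil n)
    (r : D.V m) : evo (gaugeChar k n r) φ = 0 := by
  have : evo (gaugeChar k n r) = (opAt r).compDer (D.adLam k m n) := by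
    refine MvPolynomial.derivation_ext fun y => ?_
    rw [compDer_apply, adLam, MvPolynomial.mkDerivation_X, evo_X, opAt_iterate_lamDel,
      map_add, opAt_C, gaugeChar]
    congr 2
    split_ifs
    · rw [opAt_C_mul_X]
    · rw [map_zero]
  rw [this, compDer_apply, hφ n hn, map_zero]

/-! ### The dressed element `M` and the variational derivatives -/

theorem eq_zero_of_forall_loopMap_eq_zero (D : Data ι 𝔤) {R : Type*} [CommRing R] [Algebra ℂ R] {X : Loop R 𝔤}
    (h : ∀ g : R →ₗ[ℂ] ℂ, loopMap 𝔤 g X = 0) : X = 0 := by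
  refine D.ext_coef fun i j => ?_
  rw [show D.coef (0 : Loop R 𝔤) i j = 0 from map_zero (D.coefₗ R i j)]
  rw [← Module.forall_dual_apply_eq_zero_iff ℂ]
  intro g
  have := congrArg (fun Y => D.coef Y i j) (h g)
  simp only [coef_loopMap] at this
  exact this.trans (map_zero (D.coefₗ ℂ i j))

theorem loopMap_const_lie {R : Type*} [CommRing R] [Algebra ℂ R] (g : R →ₗ[ℂ] ℂ) (b : Loop ℂ 𝔤)
    (X : Loop R 𝔤) : loopMap 𝔤 g ⁅const R b, X⁆ = ⁅b, loopMap 𝔤 g X⁆ := by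
  have := loopMap_lie g (Algebra.linearMap ℂ R) LinearMap.id LinearMap.id 0 g 0
    (fun r s => by simp [← Algebra.smul_def]) b X
  simpa using this

/-- The hypothesis concerns complex coefficients only. Linear functionals on `𝒱` separate
coefficients and commute with bracketing by the constant elements `b` and `Λ_m`. -/
theorem incl_lie_eq_zero {b : Loop ℂ 𝔤}
    (hbc : ∀ c : Loop ℂ 𝔤, ⁅D.Lam ℂ m, c⁆ = 0 → ⁅b, c⁆ = 0) {X : Loop (D.V m) 𝔤}
    (hX : ⁅D.Lam (D.V m) m, X⁆ = 0) : ⁅D.incl m b, X⁆ = 0 := by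
  have hΛ : const (D.V m) (D.Lam ℂ m) = D.Lam (D.V m) m := D.loopMap_Lam _ (by simp) m
  refine D.eq_zero_of_forall_loopMap_eq_zero fun g => ?_
  have h₁ : loopMap 𝔤 g ⁅D.incl m b, X⁆ = ⁅b, loopMap 𝔤 g X⁆ := loopMap_const_lie g b X
  rw [h₁]
  refine hbc _ ?_
  rw [← loopMap_const_lie, hΛ, hX, map_zero]

theorem mono_zero (R : Type*) [CommRing R] [Algebra ℂ R] (a : 𝔤) (j : ℤ) :
    (mono a j 0 : Loop R 𝔤) = 0 := by
  rw [mono, HahnSeries.single_eq_zero, TensorProduct.zero_tmul]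

theorem d_Lam (x : D.Idx m) : (symbolVariation x).d (D.Lam (D.V m) m) = 0 := by
  have h1 : (symbolVariation x).toLin 1 = 0 := Derivation.map_one_eq_zero (symbol x)
  rw [Lam, map_sub, map_neg]
  simp only [loopMap_mono, h1, mono_zero]
  simp

theorem d_lax (x : D.Idx m) : (symbolVariation x).d (D.lax m) =
    mono (D.ut x.1.1) (-((x.1.2 : ℕ) : ℤ)) 1 := by
  have hT : ∀ r, (symbolVariation x).toLin r = symbol x r := fun _ => rfl
  rw [lax, map_add, d_Lam, add_zero, map_sum]
  simp only [loopMap_mono, hT, symbol_X]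
  rw [sum_eq_single x]
  · simp
  · intro y _ hy
    rw [if_neg hy, mono_zero]
  · simp

/-- `apply_pair_const_d` for the Fréchet derivative in direction `x`: `Λ_m` is constant and `dQ` is
the dual vector of the generator, which reads off one coefficient of `M`. -/
theorem varDer_Ham {k : ℂ} {S H M : Loop (D.V m) 𝔤} {b : Loop ℂ 𝔤} (hSH : D.IsDiag k m S H)
    (hM : D.IsExpAd m (-S) (0, D.incl m b) (0, M))
    (hb : ⁅D.incl m b, D.Lam (D.V m) m + H⁆ = 0) (x : D.Idx m) :
    varDer x (D.Ham m b H) = D.coef M x.1.1 ((x.1.2 : ℕ) : ℤ) := by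
  obtain ⟨hS, -, hexp⟩ := hSH
  have hS' : S ∈ D.filt (D.V m) 1 := fun i j h => hS i j (by omega)
  have key := (symbolVariation x).apply_pair_const_d hS' hexp hM hb (adjointAtZero D m)
    adjointAtZero_lamDel
  have h₂ : symbol x (D.Ham m b H) =
      D.pair (const (Polynomial (D.V m)) b) ((symbolVariation x).d H) := by
    have := D.map_pair (symbol x : D.V m →ₗ[ℂ] Polynomial (D.V m)) (Algebra.linearMap ℂ (D.V m))
      LinearMap.id (Algebra.linearMap ℂ (Polynomial (D.V m))) 0
      (symbol x : D.V m →ₗ[ℂ] Polynomial (D.V m)) 0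
      (fun r s => by
        rw [show Algebra.linearMap ℂ (D.V m) r * LinearMap.id s = r • s from
            (Algebra.smul_def r s).symm, map_smul, LinearMap.zero_apply, zero_mul, add_zero]
        exact Algebra.smul_def r _) b H
    rw [loopMap_id, loopMap_zero, ← pairing_apply, ← pairing_apply, ← pairing_apply,
      map_zero, LinearMap.zero_apply, add_zero] at this
    exact this
  rw [map_add, d_Lam, zero_add, d_lax, pair_mono_ut, neg_neg, coef_loopMap, mul_one] at key
  rw [varDer, h₂, key]
  -- The coefficient of `M` enters `𝒱[λ]` free of `λ`, so the adjoint leaves it unchanged.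
  exact adjointAtZero_monomial 0 _

/-! ### Shifts by powers of `z` -/

theorem loop_lie_smul {R : Type*} [CommRing R] [Algebra ℂ R] (s : LaurentSeries R)
    (X Y : Loop R 𝔤) : ⁅X, s • Y⁆ = s • ⁅X, Y⁆ := lie_smul s X Y

theorem coef_single_smul {R : Type*} [CommRing R] [Algebra ℂ R] (X : Loop R 𝔤) (i : ι) (j : ℤ) :
    D.coef ((HahnSeries.single (-1 : ℤ) (1 : R) : LaurentSeries R) • X) i j =
      D.coef X i (j + 1) := by
  rw [coef_eq, coord_smul]
  have := HahnSeries.coeff_single_mul_add (r := (1 : R)) (x := D.coord X i) (a := j + 1) (b := -1)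
  rw [add_neg_cancel_right, one_mul] at this
  exact this

theorem incl_single_smul (b : Loop ℂ 𝔤) :
    D.incl m ((HahnSeries.single (-1 : ℤ) (1 : ℂ) : LaurentSeries ℂ) • b) =
      (HahnSeries.single (-1 : ℤ) (1 : D.V m) : LaurentSeries (D.V m)) • D.incl m b := by
  refine D.ext_coef fun i j => ?_
  rw [coef_single_smul, incl, coef_loopMap, coef_loopMap, coef_single_smul]

/-- Without a `∂` component `ad S` is linear over Laurent series, so dressing `z⁻¹b` yields `z⁻¹M`.
-/
theorem IsExpAd.smul {S X M : Loop (D.V m) 𝔤} (h : D.IsExpAd m S (0, X) (0, M)) :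
    D.IsExpAd m S
      (0, (HahnSeries.single (-1 : ℤ) (1 : D.V m) : LaurentSeries (D.V m)) • X)
      (0, (HahnSeries.single (-1 : ℤ) (1 : D.V m) : LaurentSeries (D.V m)) • M) := by
  set s := (HahnSeries.single (-1 : ℤ) (1 : D.V m) : LaurentSeries (D.V m))
  have hit : ∀ r : ℕ, (D.adLax m S)^[r] (0, s • X) =
      (0, s • ((D.adLax m S)^[r] (0, X)).2) ∧ ((D.adLax m S)^[r] (0, X)).1 = 0 := by
    intro r
    induction r with
    | zero => exact ⟨rfl, rfl⟩
    | succ r ih =>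
      rw [Function.iterate_succ_apply', Function.iterate_succ_apply', ih.1, adLax, adLax, ih.2]
      simp only [zero_smul, sub_zero, and_true]
      rw [loop_lie_smul]
  refine ⟨rfl, fun i j => ?_⟩
  filter_upwards [h.2 i (j + 1)] with N hN
  rw [coef_single_smul, ← hN, ← coef_single_smul, smul_sum]
  congr 1
  refine sum_congr rfl fun r _ => ?_
  rw [(hit r).1, smul_comm]

/-! ### The flow -/

/-- The characteristic of the flow. -/
def flowChar (k : ℂ) (N : Loop (D.V m) 𝔤) (y : D.Idx m) : D.V m :=
  k • D.del m (D.pair N (mono (D.u y.1.1) ((y.1.2 : ℕ) : ℤ) (1 : D.V m))) +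
    D.pair N ⁅mono (D.u y.1.1) ((y.1.2 : ℕ) : ℤ) (1 : D.V m), D.lax m⁆

theorem flow_eq_evo (k : ℂ) (N : Loop (D.V m) 𝔤) : D.flow k m N = evo (flowChar k N) := rfl

theorem flowChar_add (k : ℂ) (N N' : Loop (D.V m) 𝔤) :
    flowChar k (N + N') = flowChar k N + flowChar k N' := by
  ext1 y
  simp only [flowChar, Pi.add_apply, pair_add_left, map_add, smul_add]
  abel

/-- By symmetry and invariance the characteristic at `u` is `(u, k∂M + [Q + Λ_m, M])`. -/
theorem flowChar_eq_zero {k : ℂ} {M : Loop (D.V m) 𝔤}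
    (h : (Connection.self D m).act (k, D.lax m) M = 0) : flowChar k M = 0 := by
  ext1 y
  have hu : mono (D.u y.1.1) ((y.1.2 : ℕ) : ℤ) (1 : D.V m) =
      const (D.V m) (mono (D.u y.1.1) ((y.1.2 : ℕ) : ℤ) 1) := by
    rw [show const (D.V m) (mono (D.u y.1.1) ((y.1.2 : ℕ) : ℤ) 1) = _ from loopMap_mono _ _ _ _]
    simp
  have h₁ := (Connection.self D m).pair_const_nabla (mono (D.u y.1.1) ((y.1.2 : ℕ) : ℤ) 1) M
  rw [← hu] at h₁
  rw [Connection.act_apply, Connection.self_up] at h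
  rw [flowChar, pair_symm, pair_symm D M ⁅_, _⁆, pair_lie]
  have h₂ : D.del m (D.pair (mono (D.u y.1.1) ((y.1.2 : ℕ) : ℤ) (1 : D.V m)) M) =
      D.pair (mono (D.u y.1.1) ((y.1.2 : ℕ) : ℤ) (1 : D.V m))
        (loopMap 𝔤 (Connection.self D m).nabla M) := h₁.symm
  rw [h₂, ← pairing_apply, ← pairing_apply, ← map_smul, ← map_add, h, map_zero, Pi.zero_apply]

/-! ### The generators -/

theorem deg_lt_top_imp (D : Data ι 𝔤) {m : ℕ} {i : ι} {j : ℕ} (h : D.deg i j < D.top m) :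
    j < m + 1 := by
  by_contra! hj
  have h₁ := D.neg_dd_le_wt i
  have h₂ := D.two_le_dd
  have : (D.dd + 2) * ((m : ℤ) + 1) ≤ (D.dd + 2) * j :=
    mul_le_mul_of_nonneg_left (by exact_mod_cast hj) (by omega)
  simp only [deg, top] at h
  rw [mul_add] at this
  omega

theorem gen_of_lt {i : ι} {j : Fin (m + 1)} (h : D.deg i (j : ℕ) < D.top m) :
    D.gen m i j = MvPolynomial.X (⟨(i, j), h⟩, 0) := by
  rw [gen, dif_pos ⟨j.2, h⟩]

theorem gen_eq_zero {i : ι} {j : ℕ} (h : D.top m < D.deg i j) : D.gen m i j = 0 := by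
  rw [gen, dif_neg, if_neg h.ne']
  rintro ⟨_, h'⟩
  exact absurd h' (not_lt.2 h.le)

theorem pair_Lam_mono_eq_zero {i : ι} {j : ℤ} (h : D.deg i j ≠ D.top m) :
    D.pair (D.Lam ℂ m) (mono (D.u i) j 1) = 0 := by
  by_contra hne
  obtain ⟨i', l, a, n, ha, hb, hab⟩ := D.exists_of_pair_ne_zero hne
  have h₁ := D.deg_eq_of_coef_Lam_ne_zero ha
  rw [coef_mono] at hb
  have hn : n = j := by
    by_contra hn
    exact hb (if_neg hn)
  have hl : l = i := by
    by_contra hl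
    refine hb ?_
    rw [Module.Basis.repr_self, Finsupp.single_eq_of_ne hl, zero_smul, ite_self]
  rw [hn, hl] at hab
  omega

/-- Above degree `top` the pairing with `Λ_m` vanishes by homogeneity, so a single formula covers
both non-variable cases. -/
theorem gen_of_le {i : ι} {j : ℕ} (h : D.top m ≤ D.deg i j) :
    D.gen m i j = MvPolynomial.C (D.pair (D.Lam ℂ m) (mono (D.u i) j 1)) := by
  rcases h.eq_or_lt with h | h
  · rw [gen, dif_neg, if_pos h.symm]
    rintro ⟨_, h'⟩
    exact absurd h' (not_lt.2 h.le)
  · rw [gen_eq_zero h, pair_Lam_mono_eq_zero h.ne', map_zero]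

theorem pair_mono_mono {R : Type*} [CommRing R] [Algebra ℂ R] (a b : 𝔤) (i j : ℤ) (r s : R) :
    D.pair (mono a i r) (mono b j s) = if i + j = 0 then D.form a b • (r * s) else 0 := by
  rw [pair, mono, mono, form_baseChange_tmul, HahnSeries.single_mul_single, HahnSeries.coeff_smul,
    HahnSeries.coeff_single]
  by_cases h : i + j = 0
  · rw [if_pos h, if_pos h.symm]
  · rw [if_neg h, if_neg (Ne.symm h), smul_zero]

theorem pair_Lam_mono (l : ι) (n : ℕ) : D.pair (D.Lam ℂ m) (mono (D.u l) n 1) =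
    -(if n = m then D.form (D.u l) D.f else 0) -
      (if n = m + 1 then D.form (D.u l) D.p else 0) := by
  rw [pair_symm, Lam, ← pairing_apply, map_sub, map_neg, pairing_apply, pairing_apply,
    pair_mono_mono, pair_mono_mono]
  have h₁ : (n : ℤ) + -(m : ℤ) = 0 ↔ n = m := by omega
  have h₂ : (n : ℤ) + (-(m : ℤ) - 1) = 0 ↔ n = m + 1 := by omega
  simp only [h₁, h₂, mul_one, smul_eq_mul]

theorem pair_Lam_right (Z : Loop (D.V m) 𝔤) : D.pair Z (D.Lam (D.V m) m) =
    ∑ l, ∑ n ∈ range (m + 2), D.coef Z l n *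
      MvPolynomial.C (D.pair (D.Lam ℂ m) (mono (D.u l) n 1)) := by
  have hl : ∀ l, ∑ n ∈ range (m + 2), D.coef Z l n *
      (MvPolynomial.C (D.pair (D.Lam ℂ m) (mono (D.u l) n 1)) : D.V m) =
      -(D.form (D.u l) D.f • D.coef Z l m) - D.form (D.u l) D.p • D.coef Z l ((m : ℤ) + 1) := by
    intro l
    have hz : ∑ n ∈ range m, D.coef Z l n *
        (MvPolynomial.C (D.pair (D.Lam ℂ m) (mono (D.u l) n 1)) : D.V m) = 0 := by
      refine sum_eq_zero fun n hn => ?_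
      have hn' := mem_range.1 hn
      rw [pair_Lam_mono, if_neg (by omega), if_neg (by omega)]
      simp
    rw [sum_range_succ, sum_range_succ, hz, zero_add, pair_Lam_mono, pair_Lam_mono,
      if_pos rfl, if_neg (by omega), if_neg (by omega), if_pos rfl, sub_zero, neg_zero, zero_sub,
      MvPolynomial.smul_eq_C_mul, MvPolynomial.smul_eq_C_mul, map_neg, map_neg]
    push_cast
    ring
  simp only [hl]
  rw [Lam, ← pairing_apply, map_sub, map_neg, pairing_apply, pairing_apply, pair_mono_right,
    pair_mono_right, sum_sub_distrib, sum_neg_distrib, neg_neg,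
    show -(-(m : ℤ) - 1) = (m : ℤ) + 1 by ring]
  simp only [mul_one]

theorem sum_idx {A : Type*} [AddCommMonoid A] (G : ι → ℕ → A) :
    ∑ x : D.Idx m, G x.1.1 x.1.2 =
      ∑ l, ∑ n ∈ range (m + 1), if D.deg l n < D.top m then G l n else 0 := by
  rw [← Finset.sum_subtype (s := univ.filter fun x : ι × Fin (m + 1) =>
      D.deg x.1 (x.2 : ℕ) < D.top m) (by simp) (fun x : ι × Fin (m + 1) => G x.1 x.2),
    sum_filter, Fintype.sum_prod_type]
  refine sum_congr rfl fun l _ => ?_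
  exact Fin.sum_univ_eq_sum_range (fun n => if D.deg l n < D.top m then G l n else 0) (m + 1)

/-- This explains the convention for non-generators: with it `Q + Λ_m` is uniformly the sum of all
`ũ_l z^{-n} ⊗ u_l z^n`. Powers up to `m + 1` are needed because of the term `p z^{-m-1}`. -/
theorem pair_lax (Z : Loop (D.V m) 𝔤) : D.pair Z (D.lax m) =
    ∑ l, ∑ n ∈ range (m + 2), D.coef Z l n * D.gen m l n := by
  have hsplit : ∀ (l : ι) (n : ℕ), D.gen m l n = (if D.deg l n < D.top m then D.gen m l n else 0) +
      MvPolynomial.C (D.pair (D.Lam ℂ m) (mono (D.u l) n 1)) := by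
    intro l n
    split_ifs with h
    · rw [pair_Lam_mono_eq_zero h.ne, map_zero, add_zero]
    · rw [zero_add, gen_of_le (not_lt.1 h)]
  have h₁ : ∑ l, ∑ n ∈ range (m + 2), D.coef Z l n * D.gen m l n =
      ∑ l, ∑ n ∈ range (m + 1), (if D.deg l n < D.top m then D.coef Z l n * D.gen m l n else 0) +
      ∑ l, ∑ n ∈ range (m + 2), D.coef Z l n *
        MvPolynomial.C (D.pair (D.Lam ℂ m) (mono (D.u l) n 1)) := by
    rw [← sum_add_distrib]
    refine sum_congr rfl fun l _ => ?_
    have h₂ : ∑ n ∈ range (m + 1), (if D.deg l n < D.top m then D.coef Z l n * D.gen m l n else 0) =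
        ∑ n ∈ range (m + 2), (if D.deg l n < D.top m then D.coef Z l n * D.gen m l n else 0) := by
      rw [sum_range_succ _ (m + 1), if_neg, add_zero]
      intro h
      exact absurd (D.deg_lt_top_imp h) (lt_irrefl _)
    rw [h₂, ← sum_add_distrib]
    refine sum_congr rfl fun n _ => ?_
    conv_lhs => rw [hsplit, mul_add]
    rw [mul_ite, mul_zero]
  rw [lax, pair_add_right, pair_Lam_right, h₁, ← sum_idx (fun l n => D.coef Z l n * D.gen m l n)]
  congr 1
  rw [← pairing_apply, map_sum]
  refine sum_congr rfl fun x _ => ?_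
  rw [pairing_apply, pair_mono_ut, neg_neg, gen_of_lt x.2]

theorem coef_lie_mono {R : Type*} [CommRing R] [Algebra ℂ R] (N : Loop R 𝔤) (y l : ι) (j n : ℤ) :
    D.coef ⁅N, mono (D.u y) j (1 : R)⁆ l n =
      ∑ i, D.u.repr ⁅D.u i, D.u y⁆ l • D.coef N i (n - j) := by
  rw [coef_eq, coord_lie, HahnSeries.coeff_sum]
  refine sum_congr rfl fun i _ => ?_
  rw [sum_eq_single y]
  · rw [HahnSeries.coeff_smul, mono, coord_tmul, Module.Basis.repr_self, Finsupp.single_eq_same,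
      one_smul, coef_eq]
    congr 1
    have := HahnSeries.coeff_mul_single_add (r := (1 : R)) (x := D.coord N i) (a := n - j) (b := j)
    rwa [sub_add_cancel, mul_one] at this
  · intro y' _ hy'
    rw [mono, coord_tmul, Module.Basis.repr_self, Finsupp.single_eq_of_ne hy', zero_smul, mul_zero,
      smul_zero]
  · simp

theorem pair_lie_lax (N : Loop (D.V m) 𝔤) (y : ι) (j : ℤ) :
    D.pair N ⁅mono (D.u y) j (1 : D.V m), D.lax m⁆ =
      ∑ i, ∑ n ∈ range (m + 2), D.cls m ⁅D.u i, D.u y⁆ n * D.coef N i (n - j) := by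
  rw [← pair_lie, pair_lax]
  simp only [coef_lie_mono, cls, sum_mul]
  rw [sum_comm]
  conv_rhs => rw [sum_comm]
  refine sum_congr rfl fun n _ => ?_
  rw [sum_comm]
  refine sum_congr rfl fun i _ => sum_congr rfl fun l _ => ?_
  rw [smul_mul_assoc, smul_mul_assoc, mul_comm]

/-! ### Comparing the flow with the two brackets -/

theorem cls_eq_zero {i y : ι} {n : ℕ} (h : D.top m < D.wt i + D.wt y + (D.dd + 2) * n) :
    D.cls m ⁅D.u i, D.u y⁆ n = 0 := by
  refine sum_eq_zero fun l _ => ?_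
  by_cases hl : D.u.repr ⁅D.u i, D.u y⁆ l = 0
  · rw [hl, zero_smul]
  · rw [gen_eq_zero, smul_zero]
    rwa [deg, D.wt_add_eq_of_repr_ne_zero hl]

theorem cls_eq_zero_of_deg {i y : ι} {a b : ℕ} (h : D.top m < D.deg i a + D.deg y b) :
    D.cls m ⁅D.u i, D.u y⁆ (a + b) = 0 := by
  refine cls_eq_zero ?_
  simp only [deg] at h
  push_cast
  linarith

theorem cls_eq_zero_of_le {i y : ι} {n : ℕ} (h : m + 2 ≤ n) : D.cls m ⁅D.u i, D.u y⁆ n = 0 := by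
  refine sum_eq_zero fun l _ => ?_
  rw [gen_eq_zero, smul_zero]
  have h₁ := D.neg_dd_le_wt l
  have h₂ := D.two_le_dd
  have : (D.dd + 2) * ((m : ℤ) + 2) ≤ (D.dd + 2) * n :=
    mul_le_mul_of_nonneg_left (by exact_mod_cast h) (by omega)
  simp only [deg, top]
  rw [mul_add] at this
  omega

theorem deg_add_pos (D : Data ι 𝔤) (y : ι) {n : ℕ} (h : 1 ≤ n) : 0 < D.deg y n := by
  have h₁ := D.neg_dd_le_wt y
  have h₂ := D.two_le_dd
  have : (D.dd + 2) * 1 ≤ (D.dd + 2) * n :=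
    mul_le_mul_of_nonneg_left (by exact_mod_cast h) (by omega)
  simp only [deg]
  omega

/-- Positive and non-negative powers of `z` pair to zero, so no derivative term appears; the
remaining sum is reindexed by `n = a + j + 1`, where `a + 1` is the power of `z` in `M`. -/
theorem flowChar_posPart (k : ℂ) (M : Loop (D.V m) 𝔤) (y : D.Idx m) :
    flowChar k (posPart _ M) y = ∑ i, ∑ a ∈ range (m + 1),
      D.cls m ⁅D.u i, D.u y.1.1⁆ (a + (y.1.2 + 1)) * D.coef M i ((a : ℤ) + 1) := by
  have h₀ : D.pair (posPart _ M) (mono (D.u y.1.1) ((y.1.2 : ℕ) : ℤ) (1 : D.V m)) = 0 := by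
    rw [pair_mono_right]
    refine sum_eq_zero fun i _ => ?_
    rw [coef_posPart, if_neg (by omega), zero_mul, smul_zero]
  rw [flowChar, h₀, map_zero, smul_zero, zero_add, pair_lie_lax]
  refine sum_congr rfl fun i _ => ?_
  set j : ℕ := (y.1.2 : ℕ)
  have h₁ : ∑ n ∈ range (m + 2),
      D.cls m ⁅D.u i, D.u y.1.1⁆ n * D.coef (posPart _ M) i ((n : ℤ) - j) =
      ∑ n ∈ range ((j + 1) + (m + 1)),
      D.cls m ⁅D.u i, D.u y.1.1⁆ n * D.coef (posPart _ M) i ((n : ℤ) - j) := by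
    refine sum_subset (by intro n; simp only [mem_range]; omega) fun n _ hn => ?_
    rw [cls_eq_zero_of_le (by simpa using hn), zero_mul]
  rw [h₁, sum_range_add, sum_eq_zero, zero_add]
  · refine sum_congr rfl fun a _ => ?_
    rw [coef_posPart, if_pos (by push_cast; omega), add_comm (j + 1) a]
    congr 2
    push_cast
    ring
  · intro n hn
    have := mem_range.1 hn
    rw [coef_posPart, if_neg (by omega), mul_zero]

/-- The extra `z` in the first bracket matches the shift of the coefficients of `M`. A pair `(i, n)`
outside the index set has degree at least `top`, and `u_y z^{j+1}` has positive degree, so the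
bracket is zero in `𝒱`. -/
theorem sum_gen₁ (M : Loop (D.V m) 𝔤) (k : ℂ) (y : D.Idx m) :
    ∑ x : D.Idx m, opAt (D.coef M x.1.1 (((x.1.2 : ℕ) : ℤ) + 1)) (D.gen₁ m x y) =
      -flowChar k (posPart _ M) y := by
  rw [flowChar_posPart, ← sum_neg_distrib]
  simp only [gen₁, map_neg, opAt_C]
  rw [sum_idx (fun i n => -(D.cls m ⁅D.u i, D.u y.1.1⁆ (n + y.1.2 + 1) *
    D.coef M i ((n : ℤ) + 1)))]
  refine sum_congr rfl fun i _ => ?_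
  rw [← sum_neg_distrib]
  refine sum_congr rfl fun n _ => ?_
  split_ifs with h
  · rw [add_assoc]
  · rw [cls_eq_zero_of_deg, zero_mul, neg_zero]
    have h₁ := D.neg_dd_le_wt y.1.1
    have h₂ := D.two_le_dd
    have : 0 ≤ (D.dd + 2) * ((y.1.2 : ℕ) : ℤ) := by positivity
    have e : D.deg y.1.1 ((y.1.2 + 1 : ℕ) : ℤ) =
        D.wt y.1.1 + (D.dd + 2) * ((y.1.2 : ℕ) : ℤ) + (D.dd + 2) := by
      simp only [deg]; push_cast; ring
    rw [e]
    omega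

theorem flowChar_nonposPart_of_eq_zero (k : ℂ) (M : Loop (D.V m) 𝔤) {y : D.Idx m}
    (hy : (y.1.2 : ℕ) = 0) : flowChar k (nonposPart _ M) y =
      ∑ i, gaugeChar k (D.u i) (D.coef M i 0) y := by
  rw [flowChar, pair_lie_lax, pair_mono_right, hy, map_sum, smul_sum, ← sum_add_distrib]
  refine sum_congr rfl fun i _ => ?_
  rw [sum_range_succ', sum_eq_zero, zero_add, gaugeChar, if_pos hy, hy, coef_nonposPart,
    coef_nonposPart, if_pos (by simp), if_pos (by simp), mul_one, Derivation.map_smul, smul_smul,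
    MvPolynomial.smul_eq_C_mul, add_comm]
  · simp
  · intro n _
    rw [coef_nonposPart, if_neg (by push_cast; omega), mul_zero]

/-- The affine bracket at `z^0` acts as a gauge transformation by the `z^0` part of `M`, restricted
to those `u_i` that are generators; `flowChar_nonposPart_of_eq_zero` has the sum over all `i`. -/
theorem sum_gen₂_of_eq_zero (k : ℂ) (M : Loop (D.V m) 𝔤) {y : D.Idx m} (hy : (y.1.2 : ℕ) = 0) :
    ∑ x : D.Idx m, opAt (D.coef M x.1.1 ((x.1.2 : ℕ) : ℤ)) (D.gen₂ k m x y) =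
      ∑ i, if D.wt i < D.top m then gaugeChar k (D.u i) (D.coef M i 0) y else 0 := by
  have h : ∀ x : D.Idx m, opAt (D.coef M x.1.1 ((x.1.2 : ℕ) : ℤ)) (D.gen₂ k m x y) =
      if (x.1.2 : ℕ) = 0 then gaugeChar k (D.u x.1.1) (D.coef M x.1.1 0) y else 0 := by
    intro x
    rw [gen₂]
    by_cases hx : (x.1.2 : ℕ) = 0
    · rw [if_pos ⟨hx, hy⟩, if_pos hx, map_add, opAt_C, opAt_C_mul_X, gaugeChar, if_pos hy, hy, hx]
      rfl
    · rw [if_neg (fun h => hx h.1), if_pos (Or.inr hy), if_neg hx, map_zero]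
  simp only [h]
  rw [sum_idx (fun i n => if n = 0 then gaugeChar k (D.u i) (D.coef M i 0) y else 0)]
  refine sum_congr rfl fun i _ => ?_
  rw [sum_range_succ', sum_eq_zero, zero_add, if_pos rfl]
  · simp [deg]
  · intro n _
    rw [if_neg (Nat.succ_ne_zero n), ite_self]

theorem sum_gen₂_of_ne_zero (k : ℂ) (M : Loop (D.V m) 𝔤) {y : D.Idx m} (hy : (y.1.2 : ℕ) ≠ 0) :
    ∑ x : D.Idx m, opAt (D.coef M x.1.1 ((x.1.2 : ℕ) : ℤ)) (D.gen₂ k m x y) =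
      -flowChar k (posPart _ M) y := by
  have h : ∀ x : D.Idx m, opAt (D.coef M x.1.1 ((x.1.2 : ℕ) : ℤ)) (D.gen₂ k m x y) =
      if (x.1.2 : ℕ) = 0 then 0 else -(D.cls m ⁅D.u x.1.1, D.u y.1.1⁆ (x.1.2 + y.1.2) *
        D.coef M x.1.1 ((x.1.2 : ℕ) : ℤ)) := by
    intro x
    rw [gen₂, if_neg (fun h => hy h.2)]
    by_cases hx : (x.1.2 : ℕ) = 0
    · rw [if_pos (Or.inl hx), if_pos hx, map_zero]
    · rw [if_neg (not_or.2 ⟨hx, hy⟩), if_neg hx, map_neg, opAt_C]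
  simp only [h]
  rw [sum_idx (fun i n => if n = 0 then 0 else -(D.cls m ⁅D.u i, D.u y.1.1⁆ (n + y.1.2) *
        D.coef M i (n : ℤ))), flowChar_posPart, ← sum_neg_distrib]
  refine sum_congr rfl fun i _ => ?_
  -- The summation ranges differ by one term, which involves the power `z^{m+1+j}` with `j ≥ 1` and
  -- is therefore zero.
  rw [sum_range_succ', if_pos rfl, ite_self, add_zero, sum_range_succ, ← add_assoc m,
    cls_eq_zero_of_le (by omega), zero_mul, add_zero, ← sum_neg_distrib]
  refine sum_congr rfl fun n _ => ?_
  rw [if_neg (Nat.succ_ne_zero n), show n + 1 + (y.1.2 : ℕ) = n + (y.1.2 + 1) by ring]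
  split_ifs with hd
  · push_cast; rfl
  · rw [show n + ((y.1.2 : ℕ) + 1) = (n + 1) + y.1.2 by ring, cls_eq_zero_of_deg, zero_mul, neg_zero]
    have := D.deg_add_pos y.1.1 (Nat.one_le_iff_ne_zero.2 hy)
    omega

/-- At `j = 0` the two sides differ by the `u_i` that are not generators; at `j > 0` the identity
`X_M = 0` exchanges `M^{≤0}` for `-M^{>0}`, which the bracket produces. -/
theorem flowChar_nonposPart (k : ℂ) {M : Loop (D.V m) 𝔤} (hM : flowChar k M = 0) :
    flowChar k (nonposPart _ M) =
      (fun y => ∑ x : D.Idx m, opAt (D.coef M x.1.1 ((x.1.2 : ℕ) : ℤ)) (D.gen₂ k m x y)) +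
      ∑ i ∈ univ.filter (fun i => D.top m ≤ D.wt i), gaugeChar k (D.u i) (D.coef M i 0) := by
  ext1 y
  rw [Pi.add_apply, Finset.sum_apply]
  by_cases hy : (y.1.2 : ℕ) = 0
  · rw [flowChar_nonposPart_of_eq_zero k M hy, sum_gen₂_of_eq_zero k M hy, sum_filter,
      ← sum_add_distrib]
    refine sum_congr rfl fun i _ => ?_
    by_cases h : D.wt i < D.top m
    · rw [if_pos h, if_neg (not_le.2 h), add_zero]
    · rw [if_neg h, if_pos (not_lt.1 h), zero_add]
  · have hsum : nonposPart _ M + posPart _ M = M := by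
      rw [posPart, LinearMap.sub_apply, LinearMap.id_apply, add_sub_cancel]
    have h₁ := flowChar_add k (nonposPart _ M) (posPart _ M)
    rw [hsum, hM] at h₁
    have h₂ := congrFun h₁.symm y
    rw [Pi.add_apply, Pi.zero_apply] at h₂
    -- A generator with `j > 0` forces `m ≥ 1`, and then `top` exceeds every weight.
    have hempty : univ.filter (fun i => D.top m ≤ D.wt i) = ∅ := by
      refine filter_eq_empty_iff.2 fun i _ => ?_
      have hm : 1 ≤ m := by have := y.1.2.2; omega
      have h₃ := D.wt_le i
      have h₄ := D.two_le_dd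
      have : (D.dd + 2) * 1 ≤ (D.dd + 2) * m :=
        mul_le_mul_of_nonneg_left (by exact_mod_cast hm) (by omega)
      simp only [top]
      omega
    rw [sum_gen₂_of_ne_zero k M hy, hempty, sum_empty, add_zero]
    exact eq_neg_of_add_eq_zero_left h₂

theorem isNil_u {i : ι} (h : 0 < D.wt i) : D.IsNil (D.u i) := by
  intro i' hi'
  rw [Module.Basis.repr_self, Finsupp.single_eq_of_ne]
  rintro rfl
  omega

end Data

end FracW

end

/-! ### The theorem -/

open FracW FracW.Data

theorem mainTheorem9 {ι 𝔤 : Type*} [Fintype ι] [DecidableEq ι] [LieRing 𝔤] [LieAlgebra ℂ 𝔤]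
    [FiniteDimensional ℂ 𝔤] [LieAlgebra.IsSimple ℂ 𝔤] (D : FracW.Data ι 𝔤) (k : ℂ) (m : ℕ)
    (hss : (LieAlgebra.ad (LaurentSeries ℂ) (FracW.Loop ℂ 𝔤) (D.Lam ℂ m)).IsSemisimple)
    (b : FracW.Loop ℂ 𝔤)
    (hb : ⁅D.Lam ℂ m, b⁆ = 0)
    (hbc : ∀ c : FracW.Loop ℂ 𝔤, ⁅D.Lam ℂ m, c⁆ = 0 → ⁅b, c⁆ = 0)
    (hneg : ∀ i j, 0 ≤ D.deg i j → D.coef b i j = 0) :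
    (∃ S H : FracW.Loop (D.V m) 𝔤, D.IsDiag k m S H) ∧
    ∀ S H : FracW.Loop (D.V m) 𝔤, D.IsDiag k m S H →
      ∃ M : FracW.Loop (D.V m) 𝔤, D.IsExpAd m (-S) (0, D.incl m b) (0, M) ∧
        ∀ φ ∈ D.W k m,
          D.flow k m (FracW.nonposPart _ M) φ = -D.flow k m (FracW.posPart _ M) φ ∧
          -D.flow k m (FracW.posPart _ M) φ =
            (D.bracket₁ m
              (D.Ham m ((HahnSeries.single (-1 : ℤ) (1 : ℂ) : LaurentSeries ℂ) • b) H) φ).eval 0 ∧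
          (D.bracket₁ m
              (D.Ham m ((HahnSeries.single (-1 : ℤ) (1 : ℂ) : LaurentSeries ℂ) • b) H) φ).eval 0 =
            (D.bracket₂ k m (D.Ham m b H) φ).eval 0 := by
  refine ⟨exists_isDiag hss k, fun S H hSH => ?_⟩
  have hS : S ∈ D.filt (D.V m) 1 := fun i j h => hSH.1 i j (by omega)
  -- Both `Λ_m` and `H` lie in the kernel of `ad Λ_m`, and `b` centralizes it.
  have hH : ⁅D.incl m b, D.Lam (D.V m) m + H⁆ = 0 := by
    rw [lie_add, incl_lie_eq_zero hbc (lie_self _), incl_lie_eq_zero hbc hSH.2.1, add_zero]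
  obtain ⟨M, hM⟩ := exists_isExpAd (neg_mem hS) ((0 : ℂ), D.incl m b)
  refine ⟨M, hM, fun φ hφ => ?_⟩
  have hact : (Connection.self D m).act (k, D.lax m) M = 0 := by
    refine act_eq_zero_of_isExpAd hS hSH.2.2 hM ?_
    have h₁ : loopMap 𝔤 (Connection.self D m).nabla (D.incl m b) = 0 := by
      rw [incl, loopMap_loopMap]
      have : (Connection.self D m).nabla ∘ₗ Algebra.linearMap ℂ (D.V m) = 0 :=
        LinearMap.ext fun c => Derivation.map_algebraMap (D.del m) c
      rw [this, loopMap_zero]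
    rw [Connection.act_apply, h₁, smul_zero, zero_add, Connection.self_up, ← lie_skew, hH, neg_zero]
  have hchar := flowChar_eq_zero hact
  have hsum : nonposPart _ M + FracW.posPart _ M = M := by
    rw [FracW.posPart, LinearMap.sub_apply, LinearMap.id_apply, add_sub_cancel]
  have hflow : D.flow k m (nonposPart _ M) φ = -D.flow k m (FracW.posPart _ M) φ := by
    have h₁ := flowChar_add k (nonposPart _ M) (FracW.posPart _ M)
    rw [hsum, hchar] at h₁
    rw [flow_eq_evo, flow_eq_evo, eq_neg_of_add_eq_zero_left h₁.symm, evo_neg,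
      Derivation.neg_apply]
  have hM' := hM.smul
  rw [← incl_single_smul] at hM'
  have hH' : ⁅D.incl m ((HahnSeries.single (-1 : ℤ) (1 : ℂ) : LaurentSeries ℂ) • b),
      D.Lam (D.V m) m + H⁆ = 0 := by
    rw [incl_single_smul, ← lie_skew, loop_lie_smul, ← lie_skew, hH, neg_zero, smul_zero, neg_zero]
  have hbr₁ : (D.bracket₁ m
      (D.Ham m ((HahnSeries.single (-1 : ℤ) (1 : ℂ) : LaurentSeries ℂ) • b) H) φ).eval 0 =
      -D.flow k m (FracW.posPart _ M) φ := by
    rw [bracket₁, eval_zero_lamBracket, flow_eq_evo, ← Derivation.neg_apply, ← evo_neg]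
    congr 2
    ext1 y
    simp only [varDer_Ham hSH hM' hH', coef_single_smul]
    exact sum_gen₁ M k y
  have hbr₂ : (D.bracket₂ k m (D.Ham m b H) φ).eval 0 = D.flow k m (nonposPart _ M) φ := by
    rw [bracket₂, eval_zero_lamBracket, flow_eq_evo, flowChar_nonposPart k hchar, evo_add, evo_sum]
    simp only [varDer_Ham hSH hM hH]
    rw [Derivation.add_apply, left_eq_add, ← Derivation.coeFnAddMonoidHom_apply, map_sum, Finset.sum_apply]
    -- The surplus gauge directions have doubled weight at least `top ≥ 2`, so they lie in `𝔫` and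
    -- annihilate `φ`.
    refine Finset.sum_eq_zero fun i hi => ?_
    refine evo_gaugeChar_eq_zero hφ (isNil_u ?_) _
    have := D.top_pos m
    have := (Finset.mem_filter.1 hi).2
    omega
  exact ⟨hflow, hbr₁.symm, by rw [hbr₁, hbr₂, hflow]⟩
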